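/- Algorithms are deterministic, on a word RAM with unit-cost arithmetic and bitwise operations on words and indirect memory access; for each fixed $k$ the program may depend on $k$. For $k$-SAT on $N$ variables words have $O(N)$ bits; for $k$-Sum words have $O(\log(U+T))$ bits, so that every input number fits in $O(1)$ words. $k$-SAT: given a $k$-CNF formula (a set of clauses with at most $k$ literals each) on $N$ variables, decide whether it is satisfiable. $k$-Sum: given integers $U\ge 1$ and $T \ge 0$ and a set $Z\subseteq\{1,\dots,U\}$ of $N$ integers, decide whether there exist $z_1,\dots,z_k\in Z$ (repetitions allowed) with $z_1+\dots+z_k=T$. - *Strong Exponential Time Hypothesis (SETH):* for every $\varepsilon>0$ there is an integer $k\ge 3$ such that $k$-SAT cannot be solved in time $O(2^{(1-\varepsilon)N})$. - *Strong $k$-Sum Hypothesis:* for every integer $k\ge 3$ and every $\varepsilon>0$, $k$-Sum restricted to instances with $U=N^{\lceil k/2\rceil}$ cannot be solved in time $O(N^{\lceil k/2\rceil-\varepsilon})$. - *Intermediate Hypothesis:* for all real $\alpha,\varepsilon>0$ there is an integer $k\ge 3$ such that $k$-Sum restricted to instances with $N\le U^{\alpha}$ cannot be solved in time $O(U^{1-\varepsilon})$.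 **Lemma.** SETH implies the Intermediate Hypothesis. Moreover, the Strong $k$-Sum Hypothesis implies the Intermediate Hypothesis. -/

import Mathlib

/-! ## Word RAM with unit-cost instructions

A program is a structured program over registers and a random-access memory. Every word
holds a natural number below `2 ^ w`, where `w` is the word size in bits; a computation that would
write a larger number is stuck. Each instruction and each evaluation of a branching or loop
condition takes one step. (Jumps can be expressed by a loop over a program-counter register, with a
constant-factor slow-down, as the program text is fixed.) -/

namespace WordRAM

/-- The arithmetic and bitwise operations on words. -/
inductive BinOp where
  | add | sub | mul | div | mod | land | lor | xor | shiftLeft | shiftRight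

/-- The value of an operation; subtraction is truncated at `0` and `x / 0 = 0`, `x % 0 = x`. -/
def BinOp.eval : BinOp → ℕ → ℕ → ℕ
  | .add, x, y => x + y
  | .sub, x, y => x - y
  | .mul, x, y => x * y
  | .div, x, y => x / y
  | .mod, x, y => x % y
  | .land, x, y => x &&& y
  | .lor, x, y => x ||| y
  | .xor, x, y => x ^^^ y
  | .shiftLeft, x, y => x <<< y
  | .shiftRight, x, y => x >>> y

/-- Programs; `r`, `a`, `b` are register names. A program mentions only finitely many registers. -/
inductive Program where
  /-- do nothing -/
  | skip
  /-- `R[r] := n` for a literal `n` -/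
  | const (r n : ℕ)
  /-- `R[r] := R[a] op R[b]` -/
  | op (o : BinOp) (r a b : ℕ)
  /-- `R[r] := M[R[a]]` -/
  | load (r a : ℕ)
  /-- `M[R[a]] := R[b]` -/
  | store (a b : ℕ)
  /-- run `p`, then `q` -/
  | seq (p q : Program)
  /-- run `p` if `R[r] ≠ 0`, otherwise `q` -/
  | branch (r : ℕ) (p q : Program)
  /-- run `p` as long as `R[r] ≠ 0` -/
  | loop (r : ℕ) (p : Program)

/-- Contents of the registers and of the memory. -/
@[ext]
structure State where
  reg : ℕ → ℕ
  mem : ℕ → ℕ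

/-- Write `v` to register `r`. -/
def State.setReg (s : State) (r v : ℕ) : State := ⟨Function.update s.reg r v, s.mem⟩

/-- Write `v` to memory cell `a`. -/
def State.setMem (s : State) (a v : ℕ) : State := ⟨s.reg, Function.update s.mem a v⟩

/-- The start state: the input in the memory cells `0, 1, 2, …`, and `0` everywhere else. -/
def startState (input : List ℕ) : State := ⟨fun _ => 0, fun i => input.getD i 0⟩

/-- `Exec w p s n s'`: with words of `w` bits, the program `p` started in state `s` terminates
in state `s'` after exactly `n` steps, without an overflow. -/
inductive Exec (w : ℕ) : Program → State → ℕ → State → Prop where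
  | skip (s : State) : Exec w .skip s 1 s
  | const (s : State) (r n : ℕ) (h : n < 2 ^ w) : Exec w (.const r n) s 1 (s.setReg r n)
  | op (s : State) (o : BinOp) (r a b : ℕ) (h : o.eval (s.reg a) (s.reg b) < 2 ^ w) :
      Exec w (.op o r a b) s 1 (s.setReg r (o.eval (s.reg a) (s.reg b)))
  | load (s : State) (r a : ℕ) (h : s.mem (s.reg a) < 2 ^ w) :
      Exec w (.load r a) s 1 (s.setReg r (s.mem (s.reg a)))
  | store (s : State) (a b : ℕ) : Exec w (.store a b) s 1 (s.setMem (s.reg a) (s.reg b))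
  | seq {p q : Program} {s s₁ s₂ : State} {m n : ℕ}
      (hp : Exec w p s m s₁) (hq : Exec w q s₁ n s₂) : Exec w (.seq p q) s (m + n) s₂
  | branch_true {p q : Program} {s s₁ : State} {r n : ℕ} (hr : s.reg r ≠ 0)
      (hp : Exec w p s n s₁) : Exec w (.branch r p q) s (n + 1) s₁
  | branch_false {p q : Program} {s s₁ : State} {r n : ℕ} (hr : s.reg r = 0)
      (hq : Exec w q s n s₁) : Exec w (.branch r p q) s (n + 1) s₁
  | loop_done {p : Program} {s : State} {r : ℕ} (hr : s.reg r = 0) : Exec w (.loop r p) s 1 s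
  | loop_step {p : Program} {s s₁ s₂ : State} {r m n : ℕ} (hr : s.reg r ≠ 0)
      (hp : Exec w p s m s₁) (hl : Exec w (.loop r p) s₁ n s₂) :
      Exec w (.loop r p) s (m + n + 1) s₂

/-- The decision problem with instances `x : I` satisfying `promise x`, presented to the
machine as the list `input x` and with answer `yes x`, is solved by one program in time
`O(time x)` on words of `O(bits x)` bits. The answer is "yes" if register `0` is nonzero at the
end. Since overflow is forbidden, the same program also works with every larger word size. -/
def SolvableInTime {I : Type} (promise : I → Prop) (input : I → List ℕ) (yes : I → Prop)
    (bits : I → ℕ) (time : I → ℝ) : Prop :=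
  ∃ (p : Program) (c C : ℕ), ∀ x : I, promise x →
    ∃ (n : ℕ) (s : State), Exec (c * bits x) p (startState (input x)) n s ∧
      (n : ℝ) ≤ C * time x ∧ (s.reg 0 ≠ 0 ↔ yes x)

end WordRAM

/-! ## Satisfiability of `k`-CNF formulas -/

/-- A `k`-CNF formula on the variables `0, …, numVars - 1`: distinct clauses, in any order,
each with at most `k` literals. The literal `(i, b)` is true if variable `i` has value `b`. -/
structure KCNF (k : ℕ) where
  numVars : ℕ
  clauses : List (List (Fin numVars × Bool))
  length_le : ∀ c ∈ clauses, c.length ≤ k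
  nodup : clauses.Nodup

namespace KCNF

variable {k : ℕ}

/-- Some assignment makes a literal in every clause true. -/
def Satisfiable (φ : KCNF k) : Prop :=
  ∃ a : Fin φ.numVars → Bool, ∀ c ∈ φ.clauses, ∃ l ∈ c, a l.1 = l.2

/-- The code `2 i + 1` of the positive and `2 i` of the negative literal of variable `i`. -/
def litCode {n : ℕ} (l : Fin n × Bool) : ℕ := 2 * (l.1 : ℕ) + l.2.toNat

/-- The number of variables, the number of clauses, and then each clause, preceded by its
number of literals. -/
def input (φ : KCNF k) : List ℕ :=
  φ.numVars :: φ.clauses.length :: φ.clauses.flatMap fun c => c.length :: c.map litCode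

end KCNF

/-- `k`-SAT on `N` variables is solved in time `O(f(N))`, with words of `O(N)` bits
(polynomially many; enough to address exponentially large memory). -/
def KSATSolvable (k : ℕ) (f : ℕ → ℝ) : Prop :=
  WordRAM.SolvableInTime (fun _ : KCNF k => True) KCNF.input KCNF.Satisfiable
    (fun φ => φ.numVars + 1) (fun φ => f φ.numVars)

/-- The Strong Exponential Time Hypothesis. -/
def SETH : Prop :=
  ∀ ε : ℝ, 0 < ε → ∃ k : ℕ, 3 ≤ k ∧ ¬ KSATSolvable k fun N => (2 : ℝ) ^ ((1 - ε) * N)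

/-! ## `k`-Sum -/

/-- A set `Z ⊆ {1, …, U}`, listed without repetitions in any order, and a target `T`. -/
structure KSumInstance where
  U : ℕ
  T : ℕ
  Z : List ℕ
  one_le_U : 1 ≤ U
  nodup : Z.Nodup
  mem_range : ∀ z ∈ Z, 1 ≤ z ∧ z ≤ U

namespace KSumInstance

/-- The number `N` of elements of `Z`. -/
def N (x : KSumInstance) : ℕ := x.Z.length

/-- There are `z₁, …, z_k ∈ Z`, not necessarily distinct, with `z₁ + ⋯ + z_k = T`. -/
def HasKSum (k : ℕ) (x : KSumInstance) : Prop :=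
  ∃ z : Fin k → ℕ, (∀ i, z i ∈ x.Z) ∧ ∑ i, z i = x.T

/-- `N`, `U`, `T`, and then the elements of `Z`. -/
def input (x : KSumInstance) : List ℕ := x.N :: x.U :: x.T :: x.Z

end KSumInstance

/-- `k`-Sum, restricted to the instances with `promise`, is solved in time `O(time)`, where every
input number fits in `O(1)` words: words have `O(log (U + T))` bits. -/
def KSumSolvable (k : ℕ) (promise : KSumInstance → Prop) (time : KSumInstance → ℝ) : Prop :=
  WordRAM.SolvableInTime promise KSumInstance.input (KSumInstance.HasKSum k)
    (fun x => Nat.size (x.U + x.T)) time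

/-- The Strong `k`-Sum Hypothesis. -/
def StrongKSumHypothesis : Prop :=
  ∀ k : ℕ, 3 ≤ k → ∀ ε : ℝ, 0 < ε →
    ¬ KSumSolvable k (fun x => x.U = x.N ^ ⌈(k : ℝ) / 2⌉₊)
      (fun x => (x.N : ℝ) ^ ((⌈(k : ℝ) / 2⌉₊ : ℝ) - ε))

/-- The Intermediate Hypothesis. -/
def IntermediateHypothesis : Prop :=
  ∀ α ε : ℝ, 0 < α → 0 < ε → ∃ k : ℕ, 3 ≤ k ∧
    ¬ KSumSolvable k (fun x => (x.N : ℝ) ≤ (x.U : ℝ) ^ α) (fun x => (x.U : ℝ) ^ (1 - ε))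

/-! For SETH, split the `n` variables of a `q`-CNF formula into `K` groups of `b ≈ n / K` variables.
Every set of one or of `q` groups must contribute exactly one number, which encodes an assignment to
its groups that falsifies no clause. A clause meets at most `q` groups, so once the chosen partial
assignments agree with each other they glue to a satisfying assignment, and conversely a satisfying
assignment restricts to a valid choice. The number of summands is `k = K.choose q + K`.

Agreement has to be tested within `(1 + o(1)) n` bits as `K` grows, since otherwise `U ^ (1 - ε)`
would not beat `2 ^ n`; a separate field for every pair of overlapping sets is too expensive. Let `x
M g` be the entry for group `g` in the number of the `q`-set `M`, and `y g` the entry in the number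
of the singleton `{g}`. Each group lies in `lam = (K - 1).choose (q - 1)` of the `q`-sets. If `∑ M,
x M g = lam * y g` for each `g`, and the total of all squares is `lam * ∑ g, y g ^ 2`, then `∑ (x M
g - y g) ^ 2 = 0`, so all entries agree (`eq_of_sum_eq_of_sum_sq_eq`). This takes `K` fields of
about `b` bits and one field of about `2 b` bits, hence `U = 2 ^ ((K + 2) * b + E)` with a constant
`E`. Singletons enter through complements `lam * (cap - V)`, which turns the equations into one
prescribed sum (`Good.sum_low_eq_iff`). A further digit in base `2 ^ ell` at position `M`, above
everything else, forces each required set to be used exactly once (`card_eq_of_sum_pow_eq`).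
`Good.hasKSum_iff` collects this.

There are at most `2 ^ (q * b + K)` numbers, so a large ratio `K / q` gives both `N ≤ U ^ α` and a
cheap reduction, while `4 ≤ ε' * K` absorbs the overhead `2 / K` in the exponent. The reduction is
an explicit program (`runs_reduce`) that ends in precisely the start state of the `k`-Sum instance,
so any `k`-Sum program can be appended to it.

For the Strong `k`-Sum Hypothesis no reduction is needed: with `U = N ^ r` and `r * α ≥ 1`, its
instances already satisfy the density promise, and `U ^ (1 - ε) = N ^ (r - r * ε)`. -/

namespace WordRAM

/-! ### Rules for reasoning about executions of programs. -/

theorem Exec.mono {w w' : ℕ} (h : w ≤ w') {p : Program} {s s' : State} {n : ℕ}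
    (e : Exec w p s n s') : Exec w' p s n s' := by
  have h2 : 2 ^ w ≤ 2 ^ w' := Nat.pow_le_pow_right (by norm_num) h
  induction e with
  | skip s => exact .skip s
  | const s r n hn => exact .const s r n (hn.trans_le h2)
  | op s o r a b hn => exact .op s o r a b (hn.trans_le h2)
  | load s r a hn => exact .load s r a (hn.trans_le h2)
  | store s a b => exact .store s a b
  | seq _ _ ih₁ ih₂ => exact .seq ih₁ ih₂
  | branch_true hr _ ih => exact .branch_true hr ih
  | branch_false hr _ ih => exact .branch_false hr ih
  | loop_done hr => exact .loop_done hr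
  | loop_step hr _ _ ih₁ ih₂ => exact .loop_step hr ih₁ ih₂

/-- The registers a program may write to. -/
def Program.writes : Program → List ℕ
  | .skip => []
  | .const r _ => [r]
  | .op _ r _ _ => [r]
  | .load r _ => [r]
  | .store _ _ => []
  | .seq p q => p.writes ++ q.writes
  | .branch _ p q => p.writes ++ q.writes
  | .loop _ p => p.writes

/-- The program contains no `store` instruction. -/
def Program.storeFree : Program → Bool
  | .store _ _ => false
  | .seq p q => p.storeFree && q.storeFree
  | .branch _ p q => p.storeFree && q.storeFree
  | .loop _ p => p.storeFree
  | _ => true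

theorem Exec.reg_eq {w : ℕ} {p : Program} {s s' : State} {n : ℕ} (e : Exec w p s n s') {r : ℕ}
    (hr : r ∉ p.writes) : s'.reg r = s.reg r := by
  induction e with
  | skip s => rfl
  | const s r n hn => simp_all [Program.writes, State.setReg]
  | op s o r a b hn => simp_all [Program.writes, State.setReg]
  | load s r a hn => simp_all [Program.writes, State.setReg]
  | store s a b => rfl
  | seq _ _ ih₁ ih₂ => simp_all [Program.writes]
  | branch_true hr _ ih => simp_all [Program.writes]
  | branch_false hr _ ih => simp_all [Program.writes]
  | loop_done hr => rfl
  | loop_step hr _ _ ih₁ ih₂ => simp_all [Program.writes]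

theorem Exec.mem_eq {w : ℕ} {p : Program} {s s' : State} {n : ℕ} (e : Exec w p s n s')
    (hp : p.storeFree) : s'.mem = s.mem := by
  induction e with
  | store s a b => simp [Program.storeFree] at hp
  | _ => simp_all [Program.storeFree, State.setReg]

/-- The program `p` started in state `s` terminates within `t` steps in a state satisfying `Q`. -/
def Runs (w : ℕ) (p : Program) (s : State) (t : ℕ) (Q : State → Prop) : Prop :=
  ∃ (n : ℕ) (s' : State), Exec w p s n s' ∧ n ≤ t ∧ Q s'

/-- The states `s` and `s'` agree in every register, and in the memory, that `p` does not write. -/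
def Frame (p : Program) (s s' : State) : Prop :=
  (∀ r, r ∉ p.writes → s'.reg r = s.reg r) ∧ (p.storeFree → s'.mem = s.mem)

namespace Runs

variable {w : ℕ} {p q : Program} {s : State} {t t' : ℕ} {Q Q' : State → Prop}

theorem mono (h : Runs w p s t Q) (ht : t ≤ t') (hQ : ∀ s', Q s' → Q' s') : Runs w p s t' Q' := by
  obtain ⟨n, s', e, hn, hq⟩ := h
  exact ⟨n, s', e, hn.trans ht, hQ s' hq⟩

/-- Specifications then only need to list what changes: for concrete programs, preservation of the
other registers, and of the memory when nothing is stored, is a decidable syntactic condition. -/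
theorem frame (h : Runs w p s t Q) : Runs w p s t fun s' => Q s' ∧ Frame p s s' := by
  obtain ⟨n, s', e, hn, hq⟩ := h
  exact ⟨n, s', e, hn, hq, fun r hr => e.reg_eq hr, e.mem_eq⟩

theorem seq (hp : Runs w p s t Q) (hq : ∀ s', Q s' → Runs w q s' t' Q') :
    Runs w (.seq p q) s (t + t') Q' := by
  obtain ⟨n, s', e, hn, h⟩ := hp
  obtain ⟨n', s'', e', hn', h'⟩ := hq s' h
  exact ⟨_, s'', .seq e e', by omega, h'⟩

/-- A loop whose condition register counts down. -/
theorem loop {r : ℕ} (I : ℕ → State → Prop) (hr : ∀ i s, I i s → s.reg r = i) {m : ℕ}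
    (hs : I m s) (hb : ∀ i s', i < m → I (i + 1) s' → Frame p s s' → Runs w p s' t (I i)) :
    Runs w (.loop r p) s (m * (t + 1) + 1) fun s' => I 0 s' ∧ Frame p s s' := by
  suffices h : ∀ i ≤ m, ∀ s', I i s' → Frame p s s' →
      Runs w (.loop r p) s' (i * (t + 1) + 1) fun s' => I 0 s' ∧ Frame p s s' from
    h m le_rfl s hs ⟨fun _ _ => rfl, fun _ => rfl⟩
  intro i
  induction i with
  | zero => exact fun _ s' h hf => ⟨1, s', .loop_done (hr 0 s' h), by omega, h, hf⟩
  | succ i ih =>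
    intro hi s' h hf
    obtain ⟨n, s₁, e, hn, h₁, hf₁⟩ := (hb i s' (by omega) h hf).frame
    obtain ⟨n', s₂, e', hn', h₂⟩ := ih (by omega) s₁ h₁
      ⟨fun r hr => (hf₁.1 r hr).trans (hf.1 r hr), fun hp => (hf₁.2 hp).trans (hf.2 hp)⟩
    refine ⟨_, s₂, .loop_step ?_ e e', ?_, h₂⟩
    · rw [hr _ s' h]; omega
    · rw [Nat.succ_mul]; omega

end Runs

/-- The weakest precondition of a loop-free program. -/
def wp (w : ℕ) : Program → (State → Prop) → State → Prop
  | .skip, Q, s => Q s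
  | .const r n, Q, s => n < 2 ^ w ∧ Q (s.setReg r n)
  | .op o r a b, Q, s => o.eval (s.reg a) (s.reg b) < 2 ^ w ∧
      Q (s.setReg r (o.eval (s.reg a) (s.reg b)))
  | .load r a, Q, s => s.mem (s.reg a) < 2 ^ w ∧ Q (s.setReg r (s.mem (s.reg a)))
  | .store a b, Q, s => Q (s.setMem (s.reg a) (s.reg b))
  | .seq p q, Q, s => wp w p (wp w q Q) s
  | .branch r p q, Q, s => (s.reg r ≠ 0 → wp w p Q s) ∧ (s.reg r = 0 → wp w q Q s)
  | .loop _ _, _, _ => False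

/-- A bound on the number of steps of a loop-free program. -/
def Program.cost : Program → ℕ
  | .seq p q => p.cost + q.cost
  | .branch _ p q => max p.cost q.cost + 1
  | _ => 1

/-- Reduces straight-line code to a symbolic computation: `simp` unfolds `wp`, and what is left are
overflow bounds and equations between final values. -/
theorem Runs.of_wp {w : ℕ} {p : Program} {s : State} {Q : State → Prop} (h : wp w p Q s) :
    Runs w p s p.cost Q := by
  induction p generalizing s Q with
  | skip => exact ⟨_, _, .skip s, le_rfl, h⟩
  | const r n => exact ⟨_, _, .const s r n h.1, le_rfl, h.2⟩
  | op o r a b => exact ⟨_, _, .op s o r a b h.1, le_rfl, h.2⟩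
  | load r a => exact ⟨_, _, .load s r a h.1, le_rfl, h.2⟩
  | store a b => exact ⟨_, _, .store s a b, le_rfl, h⟩
  | seq p q ihp ihq => exact (ihp h).seq fun s' h' => ihq h'
  | branch r p q ihp ihq =>
    by_cases hr : s.reg r = 0
    · obtain ⟨n, s', e, hn, hq⟩ := ihq (h.2 hr)
      exact ⟨_, s', .branch_false hr e, by simp only [Program.cost]; omega, hq⟩
    · obtain ⟨n, s', e, hn, hq⟩ := ihp (h.1 hr)
      exact ⟨_, s', .branch_true hr e, by simp only [Program.cost]; omega, hq⟩
  | loop r p _ => exact h.elim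

/-- Sequential composition of a list of programs. -/
def block : List Program → Program
  | [] => .skip
  | p :: ps => .seq p (block ps)

end WordRAM

namespace SATToKSum

open Finset

/-! ### Digits -/

/-- Uniqueness of base-`B` digits with an unbounded leading coefficient. The induction absorbs the
last digit into that coefficient and recovers it modulo `B`. It separates the mask digits as well as
the fields of the moments. -/
theorem digits_inj {B : ℕ} (K : ℕ) {a a' : ℕ → ℕ} {c c' : ℕ} (ha : ∀ g < K, a g < B)
    (ha' : ∀ g < K, a' g < B)
    (h : ∑ g ∈ range K, a g * B ^ g + c * B ^ K = ∑ g ∈ range K, a' g * B ^ g + c' * B ^ K) :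
    (∀ g < K, a g = a' g) ∧ c = c' := by
  induction K generalizing c c' with
  | zero => simpa using h
  | succ K ih =>
    rw [sum_range_succ, sum_range_succ] at h
    have h1 := ih (c := a K + c * B) (c' := a' K + c' * B) (fun g hg => ha g (by omega))
      (fun g hg => ha' g (by omega)) (by rw [pow_succ] at h; nlinarith)
    have hK := ha K (by omega)
    have hK' := ha' K (by omega)
    have h2 : a K = a' K := by
      have := congrArg (· % B) h1.2
      simpa [Nat.add_mul_mod_self_right, Nat.mod_eq_of_lt, hK, hK'] using this
    refine ⟨fun g hg => ?_, ?_⟩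
    · rcases Nat.lt_succ_iff_lt_or_eq.1 hg with hg | rfl
      · exact h1.1 g hg
      · exact h2
    · have h3 : c * B = c' * B := by have := h1.2; omega
      exact Nat.eq_of_mul_eq_mul_right (by omega) h3

theorem sum_blocks_lt {b : ℕ} (K : ℕ) {a : ℕ → ℕ} (ha : ∀ g < K, a g < 2 ^ b) :
    ∑ i ∈ range K, a i * 2 ^ (i * b) < 2 ^ (K * b) := by
  induction K with
  | zero => simp
  | succ K ih =>
    have h1 := ih fun g hg => ha g (by omega)
    have h2 := ha K (by omega)
    rw [sum_range_succ, Nat.succ_mul, pow_add]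
    have : (a K + 1) * 2 ^ (K * b) ≤ 2 ^ b * 2 ^ (K * b) := Nat.mul_le_mul_right _ h2
    nlinarith

theorem testBit_sum_blocks {b : ℕ} (K : ℕ) {a : ℕ → ℕ} (ha : ∀ g < K, a g < 2 ^ b) {g j : ℕ}
    (hg : g < K) (hj : j < b) :
    (∑ i ∈ range K, a i * 2 ^ (i * b)).testBit (g * b + j) = (a g).testBit j := by
  induction K with
  | zero => omega
  | succ K ih =>
    have h1 := sum_blocks_lt K fun g hg => ha g (by omega)
    rw [sum_range_succ, add_comm, mul_comm (a K), Nat.testBit_two_pow_mul_add _ h1]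
    rcases Nat.lt_succ_iff_lt_or_eq.1 hg with hg | rfl
    · rw [if_pos, ih (fun g hg => ha g (by omega)) hg]
      calc g * b + j < (g + 1) * b := by rw [Nat.succ_mul]; omega
        _ ≤ K * b := Nat.mul_le_mul_right _ hg
    · rw [if_neg (by omega)]; simp

/-- The number of elements below `g` of the set with bit mask `M`. -/
def cnt (M g : ℕ) : ℕ := #{i ∈ range g | M.testBit i}

theorem cnt_succ (M g : ℕ) : cnt M (g + 1) = cnt M g + if M.testBit g then 1 else 0 := by
  unfold cnt
  rw [range_add_one, filter_insert]
  split_ifs <;> simp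

theorem cnt_mono (M : ℕ) {g h : ℕ} (hgh : g ≤ h) : cnt M g ≤ cnt M h :=
  card_le_card (filter_subset_filter _ (range_mono hgh))

theorem cnt_lt {M g h : ℕ} (hgh : g < h) (hM : M.testBit g) : cnt M g + 1 ≤ cnt M h := by
  have := cnt_succ M g
  rw [if_pos hM] at this
  rw [← this]
  exact cnt_mono M hgh

/-- The value that the code `e` in base `d` assigns to the element `g` of the set `M`. -/
def dig (d M e g : ℕ) : ℕ := e / d ^ cnt M g % d

theorem dig_lt {d : ℕ} (hd : 0 < d) (M e g : ℕ) : dig d M e g < d := Nat.mod_lt _ hd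

/-- The entry depends only on the code modulo `d ^ (cnt M g + 1)`, so appending higher digits leaves
it unchanged. -/
theorem dig_eq (d M e g : ℕ) : dig d M e g = e % d ^ (cnt M g + 1) / d ^ cnt M g := by
  rw [dig, pow_succ, Nat.mod_mul_right_div_self]

theorem dig_inj {d M e e' : ℕ} (K : ℕ) (he : e < d ^ cnt M K) (he' : e' < d ^ cnt M K)
    (h : ∀ g < K, M.testBit g → dig d M e g = dig d M e' g) : e = e' := by
  -- The codes agree modulo growing powers of `d`: each element of `M` fixes one more digit, and the
  -- other elements leave the modulus as it is.
  have key : ∀ g ≤ K, e % d ^ cnt M g = e' % d ^ cnt M g := by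
    intro g
    induction g with
    | zero => intro _; simp [cnt, Nat.mod_one]
    | succ g ih =>
      intro hg
      rw [cnt_succ]
      have h1 := ih (by omega)
      split_ifs with hM
      · rw [Nat.mod_pow_succ, Nat.mod_pow_succ, h1]
        congr 2
        exact h g hg hM
      · exact h1
  simpa [Nat.mod_eq_of_lt he, Nat.mod_eq_of_lt he'] using key K le_rfl

theorem exists_dig {d M : ℕ} (K : ℕ) {y : ℕ → ℕ} (hy : ∀ g, y g < d) :
    ∃ e < d ^ cnt M K, ∀ g < K, M.testBit g → dig d M e g = y g := by
  induction K with
  | zero => exact ⟨0, by simp [cnt], by simp⟩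
  | succ K ih =>
    obtain ⟨e, he, h⟩ := ih
    have hd : 0 < d := (Nat.zero_le _).trans_lt (hy 0)
    by_cases hM : M.testBit K
    · refine ⟨e + d ^ cnt M K * y K, ?_, fun g hg hMg => ?_⟩
      · rw [cnt_succ, if_pos hM, pow_succ]
        have : d ^ cnt M K * (y K + 1) ≤ d ^ cnt M K * d := Nat.mul_le_mul_left _ (hy K)
        nlinarith
      · rcases Nat.lt_succ_iff_lt_or_eq.1 hg with hg | rfl
        · rw [← h g hg hMg, dig_eq, dig_eq]
          obtain ⟨r, hr⟩ := pow_dvd_pow d (cnt_lt hg hMg)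
          rw [hr, mul_assoc, Nat.add_mul_mod_self_left]
        · rw [dig, Nat.add_mul_div_left _ _ (by positivity), Nat.div_eq_of_lt he, zero_add,
            Nat.mod_eq_of_lt (hy _)]
    · refine ⟨e, by rwa [cnt_succ, if_neg hM], fun g hg hMg => ?_⟩
      rcases Nat.lt_succ_iff_lt_or_eq.1 hg with hg | rfl
      · exact h g hg hMg
      · exact absurd hMg hM

/-- The partial assignment with code `e` to the groups in `M` below `g`, as a bit string in which
every group occupies `b` bits. -/
def word (b M e g : ℕ) : ℕ :=
  ∑ i ∈ range g, if M.testBit i then dig (2 ^ b) M e i * 2 ^ (i * b) else 0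

/-- The entries of a partial assignment in separate fields of `f` bits, and the sum of their
squares from bit `h` on. -/
def moment (b f h M e g : ℕ) : ℕ :=
  ∑ i ∈ range g, if M.testBit i then
    dig (2 ^ b) M e i * 2 ^ (i * f) + dig (2 ^ b) M e i * dig (2 ^ b) M e i * 2 ^ h else 0

theorem word_eq (b M e g : ℕ) :
    word b M e g = ∑ i ∈ range g, (if M.testBit i then dig (2 ^ b) M e i else 0) * 2 ^ (i * b) := by
  simp [word, ite_mul]

theorem moment_eq (b f h M e g : ℕ) :
    moment b f h M e g =
      ∑ i ∈ range g, (if M.testBit i then dig (2 ^ b) M e i else 0) * (2 ^ f) ^ i +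
      (∑ i ∈ range g, (if M.testBit i then dig (2 ^ b) M e i else 0) ^ 2) * 2 ^ h := by
  rw [moment, sum_mul, ← sum_add_distrib]
  refine sum_congr rfl fun i _ => ?_
  split_ifs
  · rw [← pow_mul]; ring
  · simp

theorem testBit_word {b M e K g j : ℕ} (hg : g < K) (hj : j < b) (hM : M.testBit g) :
    (word b M e K).testBit (g * b + j) = (dig (2 ^ b) M e g).testBit j := by
  rw [word_eq, testBit_sum_blocks K _ hg hj, if_pos hM]
  intro g _
  split_ifs
  · exact dig_lt (by positivity) _ _ _
  · positivity

/-! ### Masks -/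

/-- The bit mask of a finite set. -/
def mask (t : Finset ℕ) : ℕ := ∑ i ∈ t, 2 ^ i

theorem testBit_mask (t : Finset ℕ) (g : ℕ) : (mask t).testBit g = decide (g ∈ t) := by
  have := toFinset_bitIndices_sum_two_pow t
  rw [Bool.eq_iff_iff, ← Nat.mem_bitIndices, ← List.mem_toFinset, mask, this]
  simp

theorem mask_injective : Function.Injective mask := fun s t h => by
  ext g
  have := testBit_mask s g
  rw [h, testBit_mask] at this
  simpa using this.symm

theorem mask_lt {K : ℕ} {t : Finset ℕ} (ht : t ⊆ range K) : mask t < 2 ^ K := by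
  refine (sum_le_sum_of_subset ht).trans_lt ?_
  have := Nat.geomSum_eq (le_refl 2) K
  rw [this]
  simp

theorem cnt_mask {K : ℕ} {t : Finset ℕ} (ht : t ⊆ range K) : cnt (mask t) K = #t := by
  unfold cnt
  congr 1
  ext i
  simp only [mem_filter, testBit_mask, decide_eq_true_eq]
  exact ⟨fun h => h.2, fun h => ⟨ht h, h⟩⟩

theorem exists_mask {K M : ℕ} (hM : M < 2 ^ K) : ∃ t ⊆ range K, mask t = M := by
  refine ⟨M.bitIndices.toFinset, fun i hi => ?_, sum_toFinset_bitIndices_two_pow M⟩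
  rw [List.mem_toFinset] at hi
  rw [mem_range]
  by_contra h
  have h1 := Nat.two_pow_le_of_mem_bitIndices hi
  have h2 : 2 ^ K ≤ 2 ^ i := Nat.pow_le_pow_right (by norm_num) (by omega)
  omega

/-- The masks of the sets of `r` groups. -/
def masks (K r : ℕ) : Finset ℕ := {M ∈ range (2 ^ K) | cnt M K = r}

theorem masks_eq (K r : ℕ) : masks K r = (powersetCard r (range K)).image mask := by
  ext M
  simp only [masks, mem_filter, mem_range, mem_image, mem_powersetCard]
  constructor
  · rintro ⟨h1, h2⟩
    obtain ⟨t, ht, rfl⟩ := exists_mask h1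
    exact ⟨t, ⟨ht, by rw [← cnt_mask ht, h2]⟩, rfl⟩
  · rintro ⟨t, ⟨ht, h⟩, rfl⟩
    exact ⟨mask_lt ht, by rw [cnt_mask ht, h]⟩

theorem card_masks (K r : ℕ) : #(masks K r) = K.choose r := by
  rw [masks_eq, card_image_of_injective _ mask_injective, card_powersetCard, card_range]

theorem masks_one (K : ℕ) : masks K 1 = (range K).image (2 ^ ·) := by
  rw [masks_eq, powersetCard_one, map_eq_image, image_image]
  refine image_congr fun i _ => ?_
  simp [mask]

/-- This count does not depend on `g`; it is the multiplicity `lam` of the consistency test. -/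
theorem card_masks_mem {K r g : ℕ} (hr : 1 ≤ r) (hg : g < K) :
    #{M ∈ masks K r | M.testBit g} = (K - 1).choose (r - 1) := by
  rw [masks_eq, filter_image, card_image_of_injective _ mask_injective]
  have := card_filter_powersetCard_subset {g} (range K) r
  simp_all [testBit_mask]

/-! ### Consistency -/

/-- A vanishing-variance argument. For fixed `g`, expanding `∑ (x M g - y g) ^ 2` and inserting the
first moment leaves `∑ x M g ^ 2 - lam * y g ^ 2`. Summed over `g` this is zero by the second
moment, so every square vanishes. One equation for the squares of all groups together is enough. -/
theorem eq_of_sum_eq_of_sum_sq_eq {V : Finset ℕ} {K lam : ℕ} {x : ℕ → ℕ → ℕ} {y : ℕ → ℕ}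
    (hc : ∀ g < K, #{M ∈ V | M.testBit g} = lam)
    (h1 : ∀ g < K, ∑ M ∈ V, (if M.testBit g then x M g else 0) = lam * y g)
    (h2 : ∑ M ∈ V, ∑ g ∈ range K, (if M.testBit g then x M g else 0) ^ 2 =
      lam * ∑ g ∈ range K, y g ^ 2)
    {M g : ℕ} (hM : M ∈ V) (hg : g < K) (hMg : M.testBit g) : x M g = y g := by
  have key : ∑ g ∈ range K, ∑ M ∈ V, (if M.testBit g then ((x M g : ℤ) - y g) ^ 2 else 0) = 0 := by
    have h3 : ∀ g ∈ range K, ∑ M ∈ V, (if M.testBit g then ((x M g : ℤ) - y g) ^ 2 else 0) =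
        ∑ M ∈ V, (((if M.testBit g then x M g else 0 : ℕ) : ℤ) ^ 2) - lam * (y g : ℤ) ^ 2 := by
      intro g hg
      have h4 : ∀ M ∈ V, (if M.testBit g then ((x M g : ℤ) - y g) ^ 2 else 0) =
          (((if M.testBit g then x M g else 0 : ℕ) : ℤ) ^ 2) -
          2 * y g * (((if M.testBit g then x M g else 0 : ℕ) : ℤ)) +
          (if M.testBit g then 1 else 0) * (y g : ℤ) ^ 2 := by
        intro M _
        split_ifs <;> push_cast <;> ring
      rw [sum_congr rfl h4, sum_add_distrib, sum_sub_distrib, ← mul_sum, ← sum_mul, ← Nat.cast_sum,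
        h1 g (mem_range.1 hg), sum_boole, hc g (mem_range.1 hg)]
      push_cast
      ring
    rw [sum_congr rfl h3, sum_sub_distrib, sum_comm, ← mul_sum]
    have h5 := congrArg (Nat.cast (R := ℤ)) h2
    push_cast at h5 ⊢
    linarith
  rw [sum_eq_zero_iff_of_nonneg] at key
  · have := key g (mem_range.2 hg)
    rw [sum_eq_zero_iff_of_nonneg] at this
    · have := this M hM
      rw [if_pos hMg] at this
      have := pow_eq_zero_iff (two_ne_zero) |>.1 this
      omega
    · intros; split_ifs <;> positivity
  · exact fun _ _ => sum_nonneg fun _ _ => by split_ifs <;> positivity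

/-- With fewer than `H` summands, no carry occurs in base `H`, so the digits of the sum are the
multiplicities. -/
theorem card_eq_of_sum_pow_eq {k H N : ℕ} (hk : k < H) (hH : 1 < H) {m : Fin k → ℕ} {V : Finset ℕ}
    (hm : ∀ i, m i < N) (hV : V ⊆ range N) (h : ∑ i, H ^ m i = ∑ M ∈ V, H ^ M) {M : ℕ}
    (hM : M < N) : #{i | m i = M} = if M ∈ V then 1 else 0 := by
  have h1 : ∑ i, H ^ m i = ∑ M ∈ range N, #{i | m i = M} * H ^ M := by
    rw [← sum_fiberwise_of_maps_to (s := univ) (t := range N) (g := m)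
      (fun i _ => mem_range.2 (hm i))]
    refine sum_congr rfl fun M _ => ?_
    rw [sum_congr rfl (g := fun _ => H ^ M), sum_const, smul_eq_mul]
    intro i hi
    rw [(mem_filter.1 hi).2]
  have h2 : ∑ M ∈ V, H ^ M = ∑ M ∈ range N, (if M ∈ V then 1 else 0) * H ^ M := by
    simp only [ite_mul, one_mul, zero_mul]
    rw [← sum_filter, filter_mem_eq_inter, inter_eq_right.2 hV]
  refine (digits_inj (B := H) (a := fun M => #{i | m i = M}) (a' := fun M => if M ∈ V then 1 else 0)
    (c := 0) (c' := 0) N (fun g _ => ?_) (fun g _ => ?_)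
    (by rw [← h1, h, ← h2])).1 M hM
  · exact (card_le_univ _).trans_lt (by simpa using hk)
  · split_ifs <;> omega

/-! ### The numbers that encode partial assignments. -/

/-- The constants of the reduction from satisfiability to `k`-Sum: the number `K` of groups of
variables, the clause width `q`, and numbers that are determined by them below. -/
structure Params where
  K : ℕ
  q : ℕ
  lam : ℕ
  ell : ℕ
  Uc : ℕ
  Tc : ℕ

namespace Params

variable (P : Params) (n : ℕ)

/-- The number of variables in a group. -/
def b : ℕ := n / P.K + 1

/-- The width of a field. -/
def f : ℕ := P.b n + P.ell

/-- The common scale of all numbers, up to constant factors. -/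
def scale : ℕ := 2 ^ ((P.K + 2) * P.b n)

/-- An upper bound for the moments. -/
def cap : ℕ := P.scale n * 2 ^ ((P.K + 1) * P.ell)

/-- The position of the field that identifies the mask. -/
def top : ℕ := P.scale n * 2 ^ ((P.K + 3) * P.ell)

/-- The moment of the partial assignment with code `e` to the groups in `M`. -/
def V (M e : ℕ) : ℕ := moment (P.b n) (P.f n) (P.f n * P.K) M e P.K

/-- The part of the number for a partial assignment that checks consistency. -/
def low (M e : ℕ) : ℕ :=
  if cnt M P.K = 1 then P.lam * (P.cap n - P.V n M e) else P.V n M e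

/-- The number for a partial assignment. -/
def value (M e : ℕ) : ℕ := P.low n M e + P.top n * 2 ^ (M * P.ell)

/-- The number of pairs of a mask and a code. -/
def total : ℕ := 2 ^ (P.q * P.b n) * 2 ^ P.K

/-- Every clause contains a literal that is true or not assigned. -/
def Passes {k : ℕ} (φ : KCNF k) (M e : ℕ) : Prop :=
  ∀ c ∈ φ.clauses, ∃ l ∈ c, M.testBit (l.1 / P.b φ.numVars) →
    (word (P.b φ.numVars) M e P.K).testBit l.1 = l.2

/-- The code is in range and the partial assignment falsifies no clause. -/
def Valid {k : ℕ} (φ : KCNF k) (M e : ℕ) : Prop :=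
  e / (2 ^ P.b φ.numVars) ^ cnt M P.K = 0 ∧ P.Passes φ M e

open Classical in
/-- The numbers of the partial assignments with index at least `i`. -/
noncomputable def items {k : ℕ} (φ : KCNF k) (i : ℕ) : List ℕ :=
  (((List.range (P.total φ.numVars)).drop i).reverse.filter
    fun j => P.Valid φ (j % 2 ^ P.K) (j / 2 ^ P.K)).map
    fun j => P.value φ.numVars (j % 2 ^ P.K) (j / 2 ^ P.K)

variable {P n}

theorem mem_items {k : ℕ} {φ : KCNF k} {z : ℕ} : z ∈ P.items φ 0 ↔
    ∃ M < 2 ^ P.K, ∃ e < 2 ^ (P.q * P.b φ.numVars), P.Valid φ M e ∧ P.value φ.numVars M e = z := by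
  simp only [items, List.drop_zero, List.mem_map, List.mem_filter, List.mem_reverse,
    List.mem_range, decide_eq_true_eq, total]
  constructor
  · rintro ⟨j, ⟨hj, hv⟩, hz⟩
    exact ⟨_, Nat.mod_lt _ (by positivity), _, Nat.div_lt_of_lt_mul (by rwa [mul_comm]), hv, hz⟩
  · rintro ⟨M, hM, e, he, hv, hz⟩
    have h1 : (M + 2 ^ P.K * e) % 2 ^ P.K = M := by
      rw [Nat.add_mul_mod_self_left, Nat.mod_eq_of_lt hM]
    have h2 : (M + 2 ^ P.K * e) / 2 ^ P.K = e := by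
      rw [Nat.add_mul_div_left _ _ (by positivity), Nat.div_eq_of_lt hM, zero_add]
    refine ⟨M + 2 ^ P.K * e, ⟨?_, by rwa [h1, h2]⟩, by rwa [h1, h2]⟩
    calc M + 2 ^ P.K * e < 2 ^ P.K * (e + 1) := by rw [mul_add]; omega
      _ ≤ 2 ^ P.K * 2 ^ (P.q * P.b φ.numVars) := Nat.mul_le_mul_left _ he
      _ = _ := mul_comm _ _

theorem length_items_le {k : ℕ} (φ : KCNF k) (i : ℕ) :
    (P.items φ i).length ≤ P.total φ.numVars - i := by
  rw [items, List.length_map]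
  refine (List.length_filter_le _ _).trans ?_
  simp

/-- The constants are large enough for the fields to be disjoint. -/
structure Good (P : Params) : Prop where
  two_le_q : 2 ≤ P.q
  q_le_K : P.q ≤ P.K
  lam_eq : P.lam = (P.K - 1).choose (P.q - 1)
  lam_lt : P.lam < 2 ^ P.ell
  picks_lt : P.K.choose P.q + P.K < 2 ^ P.ell
  Tc_eq : P.Tc = P.lam * P.K * 2 ^ ((P.K + 1) * P.ell) +
    2 ^ ((P.K + 3) * P.ell) * ∑ M ∈ masks P.K 1 ∪ masks P.K P.q, (2 ^ P.ell) ^ M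

theorem Good.K_pos (hP : P.Good) : 0 < P.K := by have := hP.two_le_q; have := hP.q_le_K; omega

theorem Good.K_lt (hP : P.Good) : P.K < 2 ^ P.ell := by have := hP.picks_lt; omega

theorem top_eq : P.top n = 2 ^ P.ell * 2 ^ P.ell * P.cap n := by
  rw [top, cap, mul_left_comm, ← pow_add, ← pow_add]
  congr 2
  ring

/-- The `K` fields take `K * f` bits and the sum of squares takes `2 * b + ell` more, which is
exactly the exponent of `cap`. -/
theorem Good.V_lt (hP : P.Good) (M e : ℕ) : P.V n M e < P.cap n := by
  have hd : ∀ i, (if M.testBit i then dig (2 ^ P.b n) M e i else 0) < 2 ^ P.b n := by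
    intro i
    split_ifs
    · exact dig_lt (by positivity) _ _ _
    · positivity
  rw [V, moment_eq]
  set a := fun i => if M.testBit i then dig (2 ^ P.b n) M e i else 0 with ha
  have h1 : ∑ i ∈ range P.K, a i * (2 ^ P.f n) ^ i < 2 ^ (P.K * P.f n) := by
    have := sum_blocks_lt (b := P.f n) P.K (a := a) fun g _ =>
      (hd g).trans_le (Nat.pow_le_pow_right (by norm_num) (by unfold f; omega))
    refine lt_of_eq_of_lt (sum_congr rfl fun i _ => ?_) this
    rw [← pow_mul, mul_comm i]
  -- Each square is at most `2 ^ (2 * b)`, and `K + 1 ≤ 2 ^ ell` leaves room for one unit more,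
  -- which covers the lower fields.
  have h2 : ∑ i ∈ range P.K, a i ^ 2 + 1 ≤ 2 ^ P.ell * 2 ^ (2 * P.b n) := by
    have h3 : ∑ i ∈ range P.K, a i ^ 2 ≤ ∑ i ∈ range P.K, 2 ^ (2 * P.b n) :=
      sum_le_sum fun i _ => by
        rw [mul_comm, pow_mul]; exact Nat.pow_le_pow_left (hd i).le 2
    rw [sum_const, card_range, smul_eq_mul] at h3
    have h4 : (P.K + 1) * 2 ^ (2 * P.b n) ≤ 2 ^ P.ell * 2 ^ (2 * P.b n) :=
      Nat.mul_le_mul_right _ hP.K_lt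
    have : 0 < 2 ^ (2 * P.b n) := by positivity
    nlinarith
  have h5 : P.cap n = 2 ^ P.ell * 2 ^ (2 * P.b n) * 2 ^ (P.f n * P.K) := by
    rw [cap, scale, ← pow_add, ← pow_add, ← pow_add]
    congr 1
    unfold f
    ring
  rw [h5]
  have h6 := Nat.mul_le_mul_right (2 ^ (P.f n * P.K)) h2
  rw [add_mul, one_mul] at h6
  rw [mul_comm P.K] at h1
  change ∑ i ∈ range P.K, a i * (2 ^ P.f n) ^ i +
    (∑ i ∈ range P.K, a i ^ 2) * 2 ^ (P.f n * P.K) < _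
  omega

theorem Good.low_le (hP : P.Good) (M e : ℕ) : P.low n M e ≤ 2 ^ P.ell * P.cap n := by
  have := hP.V_lt (n := n) M e
  rw [low]
  split_ifs
  · exact Nat.mul_le_mul hP.lam_lt.le (Nat.sub_le _ _)
  · calc P.V n M e ≤ 1 * P.cap n := by omega
      _ ≤ _ := Nat.mul_le_mul_right _ Nat.one_le_two_pow

theorem cap_pos : 0 < P.cap n := by unfold cap scale; positivity

theorem Good.low_lt_top (hP : P.Good) (M e : ℕ) : P.low n M e < P.top n := by
  refine (hP.low_le M e).trans_lt ?_
  rw [top_eq]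
  have h1 : 1 < 2 ^ P.ell := by have := hP.K_lt; have := hP.K_pos; omega
  have h2 : 0 < 2 ^ P.ell * P.cap n := mul_pos (by positivity) cap_pos
  nlinarith

theorem Good.mask_eq_of_value_eq (hP : P.Good) {M M' e e' : ℕ}
    (h : P.value n M e = P.value n M' e') : M = M' ∧ P.low n M e = P.low n M' e' := by
  have h0 : 0 < P.top n := (Nat.zero_le _).trans_lt (hP.low_lt_top (n := n) M e)
  unfold value at h
  have h1 := congrArg (· / P.top n) h
  simp only [Nat.add_mul_div_left _ _ h0, Nat.div_eq_of_lt (hP.low_lt_top _ _), zero_add] at h1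
  rw [h1] at h
  have h2 := Nat.pow_right_injective (le_refl 2) h1
  have h3 : P.ell ≠ 0 := by
    intro h3
    have := hP.K_lt
    have := hP.K_pos
    rw [h3] at *
    omega
  exact ⟨Nat.eq_of_mul_eq_mul_right (by omega) h2, by omega⟩

/-- Needed because a `k`-Sum instance is a set. The mask is the part above `top`, and the linear
fields of the moment already determine every entry. -/
theorem Good.value_inj (hP : P.Good) {M M' e e' : ℕ} (he : e < (2 ^ P.b n) ^ cnt M P.K)
    (he' : e' < (2 ^ P.b n) ^ cnt M' P.K) (h : P.value n M e = P.value n M' e') :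
    M = M' ∧ e = e' := by
  obtain ⟨rfl, h1⟩ := hP.mask_eq_of_value_eq h
  refine ⟨rfl, dig_inj P.K he he' ?_⟩
  -- For singletons the moment is multiplied by `lam`, so it can be recovered only because `lam ≠
  -- 0`.
  by_cases hlam : cnt M P.K = 1 ∧ P.lam = 0
  · have := hlam.2
    rw [hP.lam_eq, Nat.choose_eq_zero_iff] at this
    have := hP.q_le_K
    have := hP.two_le_q
    omega
  have h2 : P.V n M e = P.V n M e' := by
    have hV := hP.V_lt (n := n) M e
    have hV' := hP.V_lt (n := n) M e'
    unfold low at h1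
    split_ifs at h1 with hc
    · have := Nat.eq_of_mul_eq_mul_left (by omega) h1
      omega
    · exact h1
  unfold V at h2
  rw [moment_eq, moment_eq, pow_mul] at h2
  have hd : ∀ e i, (if M.testBit i then dig (2 ^ P.b n) M e i else 0) < 2 ^ P.f n := by
    intro e i
    split_ifs
    · exact (dig_lt (by positivity) _ _ _).trans_le
        (Nat.pow_le_pow_right (by norm_num) (by unfold f; omega))
    · positivity
  have h3 := (digits_inj P.K (fun g _ => hd e g) (fun g _ => hd e' g) h2).1
  intro g hg hM
  simpa [hM] using h3 g hg

theorem Good.nodup_items (hP : P.Good) {k : ℕ} (φ : KCNF k) (i : ℕ) : (P.items φ i).Nodup := by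
  classical
  unfold items
  refine List.Nodup.map_on ?_
    ((List.nodup_reverse.2 (List.nodup_range.sublist (List.drop_sublist _ _))).filter _)
  intro x hx y hy h
  simp only [List.mem_filter, decide_eq_true_eq] at hx hy
  have hpos : ∀ M, 0 < (2 ^ P.b φ.numVars) ^ cnt M P.K := fun M => by positivity
  have h1 := hP.value_inj ((Nat.div_eq_zero_iff_lt (hpos _)).1 hx.2.1)
    ((Nat.div_eq_zero_iff_lt (hpos _)).1 hy.2.1) h
  rw [← Nat.mod_add_div x (2 ^ P.K), ← Nat.mod_add_div y (2 ^ P.K), h1.1, h1.2]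

/-! ### Consistency of a family of partial assignments -/

theorem Good.disjoint_masks (hP : P.Good) : Disjoint (masks P.K 1) (masks P.K P.q) := by
  rw [Finset.disjoint_left]
  intro M h1 h2
  simp only [masks, mem_filter] at h1 h2
  have := hP.two_le_q
  omega

/-- Each singleton contributes `lam * cap - lam * V`, so a constant target for the sum is the same
as an equality between the moments of the two kinds of masks. -/
theorem Good.sum_low_eq_iff (hP : P.Good) (e : ℕ → ℕ) :
    ∑ M ∈ masks P.K 1 ∪ masks P.K P.q, P.low n M (e M) = P.lam * P.K * P.cap n ↔
      ∑ M ∈ masks P.K P.q, P.V n M (e M) = P.lam * ∑ g ∈ range P.K, P.V n (2 ^ g) (e (2 ^ g)) := by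
  rw [sum_union hP.disjoint_masks]
  have h1 : ∑ M ∈ masks P.K 1, P.low n M (e M) =
      ∑ g ∈ range P.K, P.lam * (P.cap n - P.V n (2 ^ g) (e (2 ^ g))) := by
    have h2 : ∀ M ∈ masks P.K 1, P.low n M (e M) = P.lam * (P.cap n - P.V n M (e M)) := by
      intro M hM
      rw [low, if_pos (mem_filter.1 hM).2]
    rw [sum_congr rfl h2, masks_one, sum_image]
    exact fun _ _ _ _ h => Nat.pow_right_injective (le_refl 2) h
  have h3 : ∑ M ∈ masks P.K P.q, P.low n M (e M) = ∑ M ∈ masks P.K P.q, P.V n M (e M) := by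
    refine sum_congr rfl fun M hM => ?_
    have := hP.two_le_q
    rw [low, if_neg (by rw [(mem_filter.1 hM).2]; omega)]
  have h4 : ∑ g ∈ range P.K, P.lam * (P.cap n - P.V n (2 ^ g) (e (2 ^ g))) +
      P.lam * ∑ g ∈ range P.K, P.V n (2 ^ g) (e (2 ^ g)) = P.lam * P.K * P.cap n := by
    rw [mul_sum, ← sum_add_distrib]
    have h5 : ∀ g ∈ range P.K, P.lam * (P.cap n - P.V n (2 ^ g) (e (2 ^ g))) +
        P.lam * P.V n (2 ^ g) (e (2 ^ g)) = P.lam * P.cap n := by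
      intro g _
      rw [← mul_add, Nat.sub_add_cancel (hP.V_lt _ _).le]
    rw [sum_congr rfl h5, sum_const, card_range, smul_eq_mul]
    ring
  rw [h1, h3]
  omega

theorem V_two_pow {g : ℕ} (hg : g < P.K) (e : ℕ) : P.V n (2 ^ g) e =
    dig (2 ^ P.b n) (2 ^ g) e g * (2 ^ P.f n) ^ g +
      dig (2 ^ P.b n) (2 ^ g) e g ^ 2 * (2 ^ P.f n) ^ P.K := by
  rw [V, moment_eq, pow_mul]
  simp only [Nat.testBit_two_pow, decide_eq_true_eq, ite_mul, zero_mul, ite_pow]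
  simp [sum_ite_eq, hg]

theorem sum_V (S : Finset ℕ) (e : ℕ → ℕ) : ∑ M ∈ S, P.V n M (e M) =
    ∑ g ∈ range P.K, (∑ M ∈ S, if M.testBit g then dig (2 ^ P.b n) M (e M) g else 0) *
      (2 ^ P.f n) ^ g +
    (∑ M ∈ S, ∑ g ∈ range P.K, (if M.testBit g then dig (2 ^ P.b n) M (e M) g else 0) ^ 2) *
      (2 ^ P.f n) ^ P.K := by
  simp only [V, moment_eq, pow_mul, sum_add_distrib, sum_mul]
  rw [sum_comm]

theorem lam_sum_V (e : ℕ → ℕ) : P.lam * ∑ g ∈ range P.K, P.V n (2 ^ g) (e (2 ^ g)) =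
    ∑ g ∈ range P.K, (P.lam * dig (2 ^ P.b n) (2 ^ g) (e (2 ^ g)) g) * (2 ^ P.f n) ^ g +
    (P.lam * ∑ g ∈ range P.K, dig (2 ^ P.b n) (2 ^ g) (e (2 ^ g)) g ^ 2) *
      (2 ^ P.f n) ^ P.K := by
  rw [sum_congr rfl fun g hg => V_two_pow (mem_range.1 hg) _, sum_add_distrib, mul_add, mul_sum,
    ← sum_mul, mul_assoc]
  simp only [mul_assoc]

/-- A field receives at most `lam < 2 ^ ell` entries below `2 ^ b`, so it does not overflow its `f =
b + ell` bits. The single equation of moments therefore splits into the linear equations and the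
quadratic one. -/
theorem Good.consistent_of_sum_low (hP : P.Good) {e : ℕ → ℕ}
    (h : ∑ M ∈ masks P.K 1 ∪ masks P.K P.q, P.low n M (e M) = P.lam * P.K * P.cap n)
    {M g : ℕ} (hM : M ∈ masks P.K P.q) (hg : g < P.K) (hMg : M.testBit g) :
    dig (2 ^ P.b n) M (e M) g = dig (2 ^ P.b n) (2 ^ g) (e (2 ^ g)) g := by
  rw [hP.sum_low_eq_iff, sum_V, lam_sum_V] at h
  have hc : ∀ g < P.K, #{M ∈ masks P.K P.q | M.testBit g} = P.lam := fun g hg => by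
    rw [hP.lam_eq, card_masks_mem (by have := hP.two_le_q; omega) hg]
  have hf : ∀ a, a ≤ P.lam * 2 ^ P.b n → a < 2 ^ P.f n := by
    intro a ha
    refine ha.trans_lt ?_
    rw [f, add_comm, pow_add]
    exact Nat.mul_lt_mul_of_pos_right hP.lam_lt (by positivity)
  have ha : ∀ g < P.K, (∑ M ∈ masks P.K P.q,
      if M.testBit g then dig (2 ^ P.b n) M (e M) g else 0) ≤ P.lam * 2 ^ P.b n := fun g hg => by
    rw [← sum_filter, ← hc g hg, ← smul_eq_mul]
    exact sum_le_card_nsmul _ _ _ fun M _ => (dig_lt (by positivity) _ _ _).le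
  obtain ⟨h1, h2⟩ := digits_inj P.K (fun g hg => hf _ (ha g hg))
    (fun g _ => hf _ (Nat.mul_le_mul_left _ (dig_lt (by positivity) _ _ _).le)) h
  exact eq_of_sum_eq_of_sum_sq_eq (x := fun M g => dig (2 ^ P.b n) M (e M) g)
    (y := fun g => dig (2 ^ P.b n) (2 ^ g) (e (2 ^ g)) g) hc h1 h2 hM hg hMg

theorem Good.sum_low_of_consistent (hP : P.Good) {e : ℕ → ℕ} {y : ℕ → ℕ}
    (h : ∀ M, ∀ g < P.K, M.testBit g → dig (2 ^ P.b n) M (e M) g = y g) :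
    ∑ M ∈ masks P.K 1 ∪ masks P.K P.q, P.low n M (e M) = P.lam * P.K * P.cap n := by
  rw [hP.sum_low_eq_iff, sum_V, lam_sum_V]
  have hc : ∀ g < P.K, #{M ∈ masks P.K P.q | M.testBit g} = P.lam := fun g hg => by
    rw [hP.lam_eq, card_masks_mem (by have := hP.two_le_q; omega) hg]
  have hs : ∀ g < P.K, dig (2 ^ P.b n) (2 ^ g) (e (2 ^ g)) g = y g := fun g hg =>
    h _ g hg (by simp)
  congr 1
  · refine sum_congr rfl fun g hg => ?_
    rw [mem_range] at hg
    rw [hs g hg, ← hc g hg, ← sum_filter,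
      sum_congr rfl fun M hM => h M g hg (mem_filter.1 hM).2, sum_const, smul_eq_mul]
  · rw [sum_comm, mul_sum]
    congr 1
    refine sum_congr rfl fun g hg => ?_
    rw [mem_range] at hg
    simp only [ite_pow, zero_pow two_ne_zero]
    rw [hs g hg, ← hc g hg, ← sum_filter,
      sum_congr rfl fun M hM => congrArg (· ^ 2) (h M g hg (mem_filter.1 hM).2), sum_const,
      smul_eq_mul]

/-! ### Solutions of the `k`-Sum instance and satisfying assignments. -/

theorem Good.card_masks (hP : P.Good) :
    #(masks P.K 1 ∪ masks P.K P.q) = P.K.choose P.q + P.K := by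
  rw [card_union_of_disjoint hP.disjoint_masks, SATToKSum.card_masks, SATToKSum.card_masks,
    Nat.choose_one_right, add_comm]

theorem Good.target_eq (hP : P.Good) : P.scale n * P.Tc = P.lam * P.K * P.cap n +
    P.top n * ∑ M ∈ masks P.K 1 ∪ masks P.K P.q, (2 ^ P.ell) ^ M := by
  rw [hP.Tc_eq, cap, top]
  ring

theorem Good.group_lt (hP : P.Good) {i : ℕ} (hi : i < n) : i / P.b n < P.K := by
  refine Nat.div_lt_of_lt_mul (hi.trans ?_)
  rw [mul_comm]
  exact Nat.lt_mul_div_succ n hP.K_pos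

theorem b_pos : 0 < P.b n := Nat.succ_pos _

theorem masks_union_lt {M : ℕ} (hM : M ∈ masks P.K 1 ∪ masks P.K P.q) : M < 2 ^ P.K := by
  rcases mem_union.1 hM with h | h <;> exact mem_range.1 (mem_filter.1 h).1

/-- A solution uses exactly one number for every mask. -/
theorem Good.exists_codes (hP : P.Good) {m e : Fin (P.K.choose P.q + P.K) → ℕ}
    (hm : ∀ i, m i < 2 ^ P.K) (h : ∑ i, P.value n (m i) (e i) = P.scale n * P.Tc) :
    ∃ E : ℕ → ℕ, (∀ M ∈ masks P.K 1 ∪ masks P.K P.q, ∃ i, m i = M ∧ e i = E M) ∧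
      ∑ M ∈ masks P.K 1 ∪ masks P.K P.q, P.low n M (E M) = P.lam * P.K * P.cap n := by
  set W := masks P.K 1 ∪ masks P.K P.q with hW
  have hcap := cap_pos (P := P) (n := n)
  have htop : 0 < P.top n := (Nat.zero_le _).trans_lt (hP.low_lt_top (n := n) 0 0)
  -- All `k < 2 ^ ell` low parts together stay below `top`, so division by `top` isolates the mask
  -- digits.
  have h1 : ∑ i, P.low n (m i) (e i) < P.top n := by
    calc ∑ i, P.low n (m i) (e i) ≤ ∑ _i : Fin (P.K.choose P.q + P.K), 2 ^ P.ell * P.cap n :=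
          sum_le_sum fun i _ => hP.low_le _ _
      _ = (P.K.choose P.q + P.K) * (2 ^ P.ell * P.cap n) := by simp
      _ < 2 ^ P.ell * (2 ^ P.ell * P.cap n) :=
          Nat.mul_lt_mul_of_pos_right hP.picks_lt (by positivity)
      _ = P.top n := by rw [top_eq, mul_assoc]
  have h2 : P.lam * P.K * P.cap n < P.top n := by
    rw [top_eq]
    exact Nat.mul_lt_mul_of_pos_right (Nat.mul_lt_mul'' hP.lam_lt hP.K_lt) hcap
  have h3 : ∑ i, P.low n (m i) (e i) + P.top n * ∑ i, (2 ^ P.ell) ^ m i =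
      P.lam * P.K * P.cap n + P.top n * ∑ M ∈ W, (2 ^ P.ell) ^ M := by
    rw [← hP.target_eq, ← h, mul_sum, ← sum_add_distrib]
    refine sum_congr rfl fun i _ => ?_
    rw [value, ← pow_mul, mul_comm P.ell]
  have h4 : ∑ i, (2 ^ P.ell) ^ m i = ∑ M ∈ W, (2 ^ P.ell) ^ M := by
    have := congrArg (· / P.top n) h3
    simpa only [Nat.add_mul_div_left _ _ htop, Nat.div_eq_of_lt h1, Nat.div_eq_of_lt h2,
      zero_add] using this
  have h5 : ∑ i, P.low n (m i) (e i) = P.lam * P.K * P.cap n := by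
    rw [h4] at h3
    exact Nat.add_right_cancel h3
  have hcount := fun M hM => card_eq_of_sum_pow_eq hP.picks_lt
    (by have := hP.K_lt; have := hP.K_pos; omega) hm
    (fun M hM => mem_range.2 (masks_union_lt hM)) h4 (M := M) hM
  have hmem : ∀ i, m i ∈ W := by
    intro i
    have := hcount (m i) (hm i)
    by_contra hi
    rw [if_neg hi, card_eq_zero] at this
    exact absurd (this ▸ mem_filter.2 ⟨mem_univ i, rfl⟩) (notMem_empty i)
  have hinj : Function.Injective m := by
    intro i j hij
    have := hcount (m i) (hm i)
    rw [if_pos (hmem i)] at this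
    exact card_le_one.1 this.le i (by simp) j (by simp [hij])
  have hpick : ∀ M, ∃ i, M ∈ W → m i = M := by
    intro M
    by_cases hM : M ∈ W
    · have := hcount M (masks_union_lt hM)
      rw [if_pos hM] at this
      obtain ⟨i, hi⟩ := card_pos.1 (this ▸ one_pos)
      exact ⟨i, fun _ => (mem_filter.1 hi).2⟩
    -- Outside `W` any index will do; one exists since `K` is positive.
    · exact ⟨⟨0, by have := hP.K_pos; omega⟩, fun h => absurd h hM⟩
  choose pick hpick using hpick
  refine ⟨fun M => e (pick M), fun M hM => ⟨pick M, hpick M hM, rfl⟩, ?_⟩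
  rw [← h5]
  refine (sum_bij (fun i _ => m i) (fun i _ => hmem i) (fun i _ j _ hij => hinj hij)
    (fun M hM => ⟨pick M, mem_univ _, hpick M hM⟩) fun i _ => ?_).symm
  simp only [hinj (hpick (m i) (hmem i))]

/-- The assignment is read off the singletons. For a given clause, its groups are enlarged to a set
of exactly `q` groups. The number for that set assigns every variable of the clause, so the literal
provided by `Passes` is actually true, and consistency transfers this to the singletons. -/
theorem Good.satisfiable_of_codes (hP : P.Good) (φ : KCNF P.q) {E : ℕ → ℕ}
    (hE : ∀ M ∈ masks P.K 1 ∪ masks P.K P.q, P.Passes φ M (E M))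
    (h : ∑ M ∈ masks P.K 1 ∪ masks P.K P.q, P.low φ.numVars M (E M) =
      P.lam * P.K * P.cap φ.numVars) : φ.Satisfiable := by
  set b := P.b φ.numVars with hb
  refine ⟨fun i => (dig (2 ^ b) (2 ^ (i / b : ℕ)) (E (2 ^ (i / b : ℕ))) (i / b)).testBit (i % b),
    fun c hc => ?_⟩
  have hsub : (c.map fun l => (l.1 : ℕ) / b).toFinset ⊆ range P.K := by
    intro g hg
    simp only [List.mem_toFinset, List.mem_map] at hg
    obtain ⟨l, _, rfl⟩ := hg
    exact mem_range.2 (hP.group_lt l.1.2)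
  have hcard : #(c.map fun l => (l.1 : ℕ) / b).toFinset ≤ P.q :=
    (List.toFinset_card_le _).trans (by simpa using φ.length_le c hc)
  obtain ⟨t, ht1, ht2, ht3⟩ := exists_subsuperset_card_eq hsub hcard (by simpa using hP.q_le_K)
  have hM : mask t ∈ masks P.K P.q := by
    rw [masks_eq]
    exact mem_image_of_mem _ (mem_powersetCard.2 ⟨ht2, ht3⟩)
  obtain ⟨l, hl, hl2⟩ := hE _ (mem_union_right _ hM) c hc
  have hbit : (mask t).testBit (l.1 / b) := by
    rw [testBit_mask, decide_eq_true_eq]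
    exact ht1 (List.mem_toFinset.2 (List.mem_map.2 ⟨l, hl, rfl⟩))
  refine ⟨l, hl, ?_⟩
  have h1 := hl2 hbit
  have hg := hP.group_lt l.1.2
  rw [← hb] at hg h1
  have h2 := hP.consistent_of_sum_low h hM hg hbit
  rw [← hb] at h2
  beta_reduce
  rw [← h1, ← h2, ← testBit_word hg (Nat.mod_lt _ b_pos) hbit, mul_comm, Nat.div_add_mod]

theorem Good.exists_codes_of_satisfiable (hP : P.Good) {φ : KCNF P.q} (h : φ.Satisfiable) :
    ∃ E : ℕ → ℕ, (∀ M, E M < (2 ^ P.b φ.numVars) ^ cnt M P.K ∧ P.Passes φ M (E M)) ∧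
      ∑ M ∈ masks P.K 1 ∪ masks P.K P.q, P.low φ.numVars M (E M) =
        P.lam * P.K * P.cap φ.numVars := by
  obtain ⟨a, ha⟩ := h
  set b := P.b φ.numVars with hb
  -- The values of a group packed into `b` bits; positions beyond the last variable are padded with
  -- `false`.
  set y : ℕ → ℕ := fun g => Nat.ofBits fun j : Fin b =>
    if h : g * b + j < φ.numVars then a ⟨_, h⟩ else false with hy
  have hylt : ∀ g, y g < 2 ^ b := fun g => Nat.ofBits_lt_two_pow _
  choose E hE1 hE2 using fun M => exists_dig (M := M) P.K hylt
  refine ⟨E, fun M => ⟨hE1 M, fun c hc => ?_⟩, hP.sum_low_of_consistent hE2⟩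
  obtain ⟨l, hl, hal⟩ := ha c hc
  refine ⟨l, hl, fun hM => ?_⟩
  have hg := hP.group_lt l.1.2
  rw [← hb] at hg hM ⊢
  have hmod : (l.1 : ℕ) % b < b := Nat.mod_lt _ b_pos
  have hl1 : (l.1 : ℕ) / b * b + l.1 % b = l.1 := by rw [mul_comm, Nat.div_add_mod]
  have h1 := testBit_word (e := E M) hg hmod hM
  rw [hl1, hE2 M _ hg hM] at h1
  rw [h1, hy]
  simp only
  rw [Nat.testBit_ofBits_lt _ _ hmod]
  simp only [hl1, Fin.is_lt, dite_true, Fin.eta]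
  exact hal

theorem Good.hasKSum_iff (hP : P.Good) (φ : KCNF P.q) :
    (∃ z : Fin (P.K.choose P.q + P.K) → ℕ, (∀ i, z i ∈ P.items φ 0) ∧
      ∑ i, z i = P.scale φ.numVars * P.Tc) ↔ φ.Satisfiable := by
  constructor
  · rintro ⟨z, hz, hsum⟩
    choose m hm e he hv hz using fun i => mem_items.1 (hz i)
    simp only [← hz] at hsum
    obtain ⟨E, hE, hlow⟩ := hP.exists_codes hm hsum
    refine hP.satisfiable_of_codes φ (fun M hM => ?_) hlow
    obtain ⟨i, rfl, hi⟩ := hE M hM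
    rw [← hi]
    exact (hv i).2
  · intro h
    obtain ⟨E, hE, hlow⟩ := hP.exists_codes_of_satisfiable h
    let σ := (equivFinOfCardEq hP.card_masks).symm
    refine ⟨fun i => P.value φ.numVars (σ i) (E (σ i)), fun i => mem_items.2
      ⟨σ i, masks_union_lt (σ i).2, _, ?_, ⟨Nat.div_eq_of_lt (hE _).1, (hE _).2⟩, rfl⟩, ?_⟩
    · refine (hE _).1.trans_le ?_
      rw [← pow_mul, mul_comm]
      refine Nat.pow_le_pow_right (by norm_num) (Nat.mul_le_mul_right _ ?_)
      have := hP.two_le_q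
      rcases mem_union.1 (σ i).2 with h | h <;> rw [(mem_filter.1 h).2]
      omega
    · rw [σ.sum_comp fun M => P.value φ.numVars M (E M), sum_coe_sort _ fun M =>
        P.value φ.numVars M (E M), hP.target_eq, ← hlow, mul_sum, ← sum_add_distrib]
      refine sum_congr rfl fun i _ => ?_
      rw [value, ← pow_mul, mul_comm P.ell]

end Params

/-! ### The reduction as a program: decoding a partial assignment. -/

open Finset WordRAM

open WordRAM.Program (const op load store branch loop)

/-- Put the next digit of the code in register `1` into the partial assignment and its moment. -/
def addDigit : Program := block [
  op .mod 8 1 26, op .div 1 1 26,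
  op .mul 9 5 25, op .shiftLeft 9 8 9, op .add 2 2 9,
  op .mul 9 5 27, op .shiftLeft 9 8 9, op .add 3 3 9,
  op .mul 9 8 8, op .shiftLeft 9 9 28, op .add 3 3 9,
  op .add 4 4 21]

/-- Process one group. -/
def decodeBody : Program := block [
  op .shiftRight 7 0 5, op .mod 7 7 22, branch 7 addDigit .skip,
  op .add 5 5 21, op .sub 6 6 21]

/-- The contents of the registers that are constant during the main loop. -/
structure Env (P : Params) (n m A : ℕ) (s : State) : Prop where
  r20 : s.reg 20 = 0
  r21 : s.reg 21 = 1
  r22 : s.reg 22 = 2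
  r24 : s.reg 24 = m
  r25 : s.reg 25 = P.b n
  r26 : s.reg 26 = 2 ^ P.b n
  r27 : s.reg 27 = P.f n
  r28 : s.reg 28 = P.f n * P.K
  r29 : s.reg 29 = P.K
  r30 : s.reg 30 = P.scale n
  r31 : s.reg 31 = P.cap n
  r32 : s.reg 32 = P.top n
  r33 : s.reg 33 = A
  r34 : s.reg 34 = P.lam
  r35 : s.reg 35 = P.ell
  r38 : s.reg 38 = 2 ^ P.K

theorem Env.congr {P : Params} {n m A : ℕ} {s s' : State} (h : Env P n m A s)
    (hs : ∀ r, 20 ≤ r → s'.reg r = s.reg r) : Env P n m A s' := by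
  constructor <;> (rw [hs _ (by norm_num)])
  exacts [h.r20, h.r21, h.r22, h.r24, h.r25, h.r26, h.r27, h.r28, h.r29, h.r30, h.r31, h.r32,
    h.r33, h.r34, h.r35, h.r38]

theorem Env.frame {P : Params} {n m A : ℕ} {s s' : State} {p : Program} (h : Env P n m A s)
    (hf : Frame p s s') (hp : ∀ r ∈ p.writes, r < 20) : Env P n m A s' :=
  h.congr fun r hr => hf.1 r fun hr' => by have := hp r hr'; omega

/-- Words of `w` bits are large enough. -/
structure Fits (P : Params) (n m A w : ℕ) : Prop where
  code : 2 * n + 2 < 2 ^ w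
  addr : A + P.total n < 2 ^ w
  addr_eq : A = m * (P.q + 1) + P.total n + 3
  const : P.K + P.q + P.lam + P.ell + P.Uc + P.Tc + 2 ^ P.K + 2 ^ ((P.K + 1) * P.ell) +
    2 ^ ((P.K + 3) * P.ell) + 3 < 2 ^ w
  exponent : (P.K + 2) * P.b n + P.q * P.b n + P.f n * P.K + 2 ^ P.K * P.ell < 2 ^ w
  value : P.lam * P.cap n + P.cap n + P.top n * 2 ^ (2 ^ P.K * P.ell) < 2 ^ w
  header : P.scale n * P.Uc + P.scale n * P.Tc < 2 ^ w

theorem Fits.K_lt {P : Params} {n m A w : ℕ} (h : Fits P n m A w) : P.K + P.q + 3 < 2 ^ w := by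
  refine lt_of_le_of_lt ?_ h.const
  simp only [add_assoc, add_le_add_iff_left]
  simp only [← add_assoc]
  exact Nat.le_add_left _ _

theorem toNat_testBit_eq (x i : ℕ) : (x >>> i) % 2 = (x.testBit i).toNat := by
  rw [Nat.toNat_testBit, Nat.shiftRight_eq_div_pow]

theorem moment_mono {b f h M e g g' : ℕ} (hg : g ≤ g') : moment b f h M e g ≤ moment b f h M e g' :=
  sum_le_sum_of_subset (range_mono hg)

theorem word_le_moment {b f h M e g : ℕ} (hbf : b ≤ f) : word b M e g ≤ moment b f h M e g := by
  refine sum_le_sum fun i _ => ?_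
  split_ifs
  · exact (Nat.mul_le_mul_left _ (Nat.pow_le_pow_right (by norm_num)
      (Nat.mul_le_mul_left _ hbf))).trans (Nat.le_add_right _ _)
  · exact le_rfl

theorem word_succ (b M e g : ℕ) : word b M e (g + 1) =
    word b M e g + if M.testBit g then dig (2 ^ b) M e g * 2 ^ (g * b) else 0 :=
  sum_range_succ _ _

theorem moment_succ (b f h M e g : ℕ) : moment b f h M e (g + 1) =
    moment b f h M e g + if M.testBit g then dig (2 ^ b) M e g * 2 ^ (g * f) +
      dig (2 ^ b) M e g * dig (2 ^ b) M e g * 2 ^ h else 0 :=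
  sum_range_succ _ _

theorem cnt_le (M g : ℕ) : cnt M g ≤ g := (card_filter_le _ _).trans (card_range g).le

variable {P : Params} {n m A w : ℕ}

theorem two_pow_K_le_total : 2 ^ P.K ≤ P.total n :=
  Nat.le_mul_of_pos_left _ (by positivity)

theorem runs_decodeBody (hP : P.Good) (hw : Fits P n m A w) {s : State} (hs : Env P n m A s)
    {M e g j : ℕ} (hM : M < 2 ^ P.K) (he : e ≤ P.total n) (hj : j + 1 + g = P.K)
    (h0 : s.reg 0 = M) (h1 : s.reg 1 = e / (2 ^ P.b n) ^ cnt M g)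
    (h2 : s.reg 2 = word (P.b n) M e g)
    (h3 : s.reg 3 = moment (P.b n) (P.f n) (P.f n * P.K) M e g) (h4 : s.reg 4 = cnt M g)
    (h5 : s.reg 5 = g) (h6 : s.reg 6 = j + 1) :
    Runs w decodeBody s decodeBody.cost fun s' =>
      s'.reg 0 = M ∧ s'.reg 1 = e / (2 ^ P.b n) ^ cnt M (g + 1) ∧
      s'.reg 2 = word (P.b n) M e (g + 1) ∧
      s'.reg 3 = moment (P.b n) (P.f n) (P.f n * P.K) M e (g + 1) ∧ s'.reg 4 = cnt M (g + 1) ∧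
      s'.reg 5 = g + 1 ∧ s'.reg 6 = j := by
  -- Overflow is excluded because all intermediate sums are bounded by the final moment, which is
  -- below `cap`, and all shift amounts by `f * K`.
  apply Runs.of_wp
  have hV := hP.V_lt (n := n) M e
  have hmono := moment_mono (b := P.b n) (f := P.f n) (h := P.f n * P.K) (M := M) (e := e)
    (show g + 1 ≤ P.K by omega)
  have hwm := word_le_moment (b := P.b n) (f := P.f n) (h := P.f n * P.K) (M := M) (e := e)
    (g := g + 1) (Nat.le_add_right _ _)
  have hMs : M >>> g ≤ M := by rw [Nat.shiftRight_eq_div_pow]; exact Nat.div_le_self _ _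
  have hKt := two_pow_K_le_total (P := P) (n := n)
  have hKw := hw.K_lt
  obtain ⟨-, haddr, -, -, hexp, hval, -⟩ := hw
  have hcnt := cnt_le M g
  unfold Params.V at hV
  by_cases hbit : M.testBit g
  · have hdig : e / (2 ^ P.b n) ^ cnt M g % 2 ^ P.b n = dig (2 ^ P.b n) M e g := rfl
    have hws := word_succ (P.b n) M e g
    have hms := moment_succ (P.b n) (P.f n) (P.f n * P.K) M e g
    have hcs := cnt_succ M g
    have hd1 : e / (2 ^ P.b n) ^ cnt M g ≤ e := Nat.div_le_self _ _
    have hd2 := Nat.div_le_self (e / (2 ^ P.b n) ^ cnt M g) (2 ^ P.b n)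
    have hd3 := Nat.mod_le (e / (2 ^ P.b n) ^ cnt M g) (2 ^ P.b n)
    have hgf : g * P.f n ≤ P.f n * P.K := by
      rw [mul_comm]; exact Nat.mul_le_mul_left _ (by omega)
    have hgb : g * P.b n ≤ g * P.f n := Nat.mul_le_mul_left _ (Nat.le_add_right _ _)
    have hsq := Nat.le_mul_of_pos_right (dig (2 ^ P.b n) M e g * dig (2 ^ P.b n) M e g)
      (show 0 < 2 ^ (P.f n * P.K) by positivity)
    have hdd : e / (2 ^ P.b n) ^ cnt M g / 2 ^ P.b n = e / (2 ^ P.b n) ^ cnt M (g + 1) := by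
      rw [hcs, if_pos hbit, Nat.div_div_eq_div_mul, pow_succ]
    have hw0 : w ≠ 0 := by rintro rfl; omega
    rw [if_pos hbit] at hws hms hcs
    simp [decodeBody, addDigit, block, wp, State.setReg, BinOp.eval, hs.r21, hs.r22, hs.r25,
      hs.r26, hs.r27, hs.r28, h0, h1, h2, h3, h4, h5, h6, toNat_testBit_eq, hbit]
    rw [hdig] at *
    simp only [Nat.shiftLeft_eq]
    refine ⟨?_, hw0, ?_, ?_, ?_, ?_, ?_, ?_, ?_, ?_, ?_, ?_, ?_, ?_, ?_, ?_, hdd, ?_, ?_, ?_⟩ <;>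
      omega
  · simp [decodeBody, block, wp, State.setReg, BinOp.eval, hs.r21, hs.r22, h0, h1, h2, h3, h4, h5,
      h6, toNat_testBit_eq, hbit, word_succ, moment_succ, cnt_succ]
    omega

theorem runs_decode (hP : P.Good) (hw : Fits P n m A w) {s : State} (hs : Env P n m A s)
    {M e : ℕ} (hM : M < 2 ^ P.K) (he : e ≤ P.total n)
    (h0 : s.reg 0 = M) (h1 : s.reg 1 = e) (h2 : s.reg 2 = 0) (h3 : s.reg 3 = 0)
    (h4 : s.reg 4 = 0) (h5 : s.reg 5 = 0) (h6 : s.reg 6 = P.K) :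
    Runs w (loop 6 decodeBody) s (P.K * (decodeBody.cost + 1) + 1) fun s' =>
      (s'.reg 1 = e / (2 ^ P.b n) ^ cnt M P.K ∧ s'.reg 2 = word (P.b n) M e P.K ∧
        s'.reg 3 = P.V n M e ∧ s'.reg 4 = cnt M P.K) ∧ Frame decodeBody s s' := by
  refine (Runs.loop (m := P.K) (fun j s' => ∃ g, j + g = P.K ∧ s'.reg 0 = M ∧
    s'.reg 1 = e / (2 ^ P.b n) ^ cnt M g ∧ s'.reg 2 = word (P.b n) M e g ∧
    s'.reg 3 = moment (P.b n) (P.f n) (P.f n * P.K) M e g ∧ s'.reg 4 = cnt M g ∧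
    s'.reg 5 = g ∧ s'.reg 6 = j) ?_ ?_ ?_).mono le_rfl ?_
  · rintro i s' ⟨g, -, -, -, -, -, -, -, h⟩
    exact h
  · exact ⟨0, by simp, h0, by simpa [cnt] using h1, by simpa [word] using h2,
      by simpa [moment] using h3, by simpa [cnt] using h4, h5, h6⟩
  · rintro i s' hi ⟨g, hg, h0, h1, h2, h3, h4, h5, h6⟩ hf
    refine (runs_decodeBody hP hw (hs.frame hf (by decide)) hM he hg h0 h1 h2 h3 h4 h5 h6).mono
      le_rfl ?_
    rintro s'' ⟨h0, h1, h2, h3, h4, h5, h6⟩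
    exact ⟨g + 1, by omega, h0, h1, h2, h3, h4, h5, h6⟩
  · rintro s' ⟨⟨g, hg, -, h1, h2, h3, h4, -, -⟩, hf⟩
    obtain rfl : g = P.K := by omega
    exact ⟨⟨h1, h2, h3, h4⟩, hf⟩

/-! ### Checking the clauses against a partial assignment. -/

/-- Read a literal and record in register `14` whether it is true or not assigned. -/
def literalBody : Program := block [
  load 7 11, op .add 11 11 21, op .div 8 7 22, op .mod 7 7 22,
  op .div 9 8 25, op .shiftRight 9 0 9, op .mod 9 9 22,
  op .shiftRight 8 2 8, op .mod 8 8 22, op .xor 8 8 7,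
  -- Register `9` says whether the group is assigned, and register `8` whether the bit differs from
  -- the sign; the literal is bad exactly if both hold.
  op .land 9 9 8, op .xor 9 9 21, op .lor 14 14 9, op .sub 13 13 21]

/-- Start reading a clause. -/
def clauseHead : Program := block [load 13 11, op .add 11 11 21, const 14 0]

/-- Finish reading a clause. -/
def clauseTail : Program := block [op .land 10 10 14, op .sub 12 12 21]

/-- Read a clause and record in register `10` whether it is falsified. -/
def clauseBody : Program := .seq clauseHead (.seq (loop 13 literalBody) clauseTail)

/-- The literal is true under the bit string `X` or its group is not in `M`. -/
def litOK (b M X : ℕ) {n : ℕ} (l : Fin n × Bool) : Bool :=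
  !M.testBit (l.1 / b) || (X.testBit l.1 == l.2)

theorem litOK_iff (b M X : ℕ) {n : ℕ} (l : Fin n × Bool) :
    litOK b M X l ↔ (M.testBit (l.1 / b) → X.testBit l.1 = l.2) := by
  unfold litOK
  cases M.testBit (l.1 / b) <;> simp

/-- The loop invariants describe the reading position by the rest of the input, `inp.drop (s.reg
11)`; this turns such a description into the value of the next load. -/
theorem drop_eq_cons {α : Type*} {l : List α} {p : ℕ} {x : α} {t : List α} (d : α)
    (h : l.drop p = x :: t) : p < l.length ∧ l.getD p d = x ∧ l.drop (p + 1) = t := by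
  have hp : p < l.length := by
    by_contra hp
    rw [List.drop_eq_nil_of_le (by omega)] at h
    cases h
  rw [List.drop_eq_getElem_cons hp] at h
  obtain ⟨rfl, rfl⟩ := List.cons.inj h
  exact ⟨hp, List.getD_eq_getElem _ _ hp, rfl⟩

theorem toNat_xor_toNat (x y : Bool) : x.toNat ^^^ y.toNat = (x ^^ y).toNat := by
  cases x <;> cases y <;> rfl

theorem toNat_and_toNat (x y : Bool) : x.toNat &&& y.toNat = (x && y).toNat := by
  cases x <;> cases y <;> rfl

theorem toNat_or_toNat (x y : Bool) : x.toNat ||| y.toNat = (x || y).toNat := by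
  cases x <;> cases y <;> rfl

theorem toNat_xor_one (x : Bool) : x.toNat ^^^ 1 = (!x).toNat := by cases x <;> rfl

theorem runs_literalBody (hw : Fits P n m A w) {s : State} (hs : Env P n m A s) {inp : List ℕ}
    (hinp : inp.length ≤ A) (hmem : ∀ i < A, s.mem i = inp.getD i 0) {M X j : ℕ}
    {l : Fin n × Bool} {t : List ℕ} {r : Bool} (h0 : s.reg 0 = M) (h2 : s.reg 2 = X)
    (hp : inp.drop (s.reg 11) = KCNF.litCode l :: t) (h13 : s.reg 13 = j + 1)
    (h14 : s.reg 14 = r.toNat) (hM : M < 2 ^ w) (hX : X < 2 ^ w) (hj : j < 2 ^ w) :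
    Runs w literalBody s literalBody.cost fun s' =>
      inp.drop (s'.reg 11) = t ∧ s'.reg 13 = j ∧
      s'.reg 14 = (r || litOK (P.b n) M X l).toNat := by
  apply Runs.of_wp
  obtain ⟨hp1, hp2, hp3⟩ := drop_eq_cons 0 hp
  have hcode := hw.code
  have haddr := hw.addr
  have hk := hw.K_lt
  have hw0 : w ≠ 0 := by rintro rfl; omega
  have hload : s.mem (s.reg 11) = KCNF.litCode l := by rw [hmem _ (by omega), hp2]
  have hc1 : KCNF.litCode l / 2 = l.1 := by
    unfold KCNF.litCode; cases l.2 <;> [simp; (simp; omega)]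
  have hc2 : KCNF.litCode l % 2 = l.2.toNat := by
    unfold KCNF.litCode; cases l.2 <;> simp
  have hc3 : KCNF.litCode l < 2 * n + 2 := by
    have := l.1.2
    unfold KCNF.litCode; cases l.2 <;> simp
    all_goals omega
  simp [literalBody, block, wp, State.setReg, BinOp.eval, hs.r21, hs.r22, hs.r25, h0, h2, h13, h14,
    toNat_testBit_eq, hload, hc1, hc2, hp3, toNat_xor_toNat, toNat_and_toNat, toNat_or_toNat,
    toNat_xor_one]
  have hb : ∀ x : Bool, x.toNat < 2 ^ w := fun x => (Bool.toNat_le x).trans_lt (by omega)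
  have hMs : M >>> (l.1 / P.b n) ≤ M := by
    rw [Nat.shiftRight_eq_div_pow]; exact Nat.div_le_self _ _
  have hXs : X >>> (l.1 : ℕ) ≤ X := by
    rw [Nat.shiftRight_eq_div_pow]; exact Nat.div_le_self _ _
  have hl := l.1.2
  have hlb := Nat.div_le_self l.1 (P.b n)
  refine ⟨by omega, by omega, by omega, hb _, by omega, by omega, hb _, by omega, hb _, hb _,
    hb _, hb _, hb _, hj, ?_⟩
  unfold litOK
  cases M.testBit (l.1 / P.b n) <;> cases X.testBit l.1 <;> cases l.2 <;> cases r <;> rfl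

theorem runs_literals (hw : Fits P n m A w) {s : State} (hs : Env P n m A s) {inp : List ℕ}
    (hinp : inp.length ≤ A) (hmem : ∀ i < A, s.mem i = inp.getD i 0) {M X : ℕ}
    {c : List (Fin n × Bool)} {t : List ℕ} (h0 : s.reg 0 = M) (h2 : s.reg 2 = X)
    (hp : inp.drop (s.reg 11) = c.map KCNF.litCode ++ t) (h13 : s.reg 13 = c.length)
    (h14 : s.reg 14 = 0) (hM : M < 2 ^ w) (hX : X < 2 ^ w) (hc : c.length < 2 ^ w) :
    Runs w (loop 13 literalBody) s (c.length * (literalBody.cost + 1) + 1) fun s' =>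
      (inp.drop (s'.reg 11) = t ∧ s'.reg 14 = (c.any (litOK (P.b n) M X)).toNat) ∧
      Frame literalBody s s' := by
  refine (Runs.loop (m := c.length) (fun j s' => ∃ (ls : List (Fin n × Bool)) (r : Bool),
    ls.length = j ∧ inp.drop (s'.reg 11) = ls.map KCNF.litCode ++ t ∧ s'.reg 13 = j ∧
    s'.reg 14 = r.toNat ∧
    (r || ls.any (litOK (P.b n) M X)) = c.any (litOK (P.b n) M X)) ?_ ?_ ?_).mono le_rfl ?_
  · rintro i s' ⟨_, _, _, _, h, _⟩
    exact h
  · exact ⟨c, false, rfl, hp, h13, h14, by simp⟩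
  · rintro i s' hi ⟨ls, r, hl, hp, h13, h14, hr⟩ hf
    obtain ⟨l, ls, rfl⟩ := List.exists_cons_of_length_eq_add_one hl
    refine (runs_literalBody (M := M) (X := X) hw (hs.frame hf (by decide)) hinp ?_
      ((hf.1 0 (by decide)).trans h0) ((hf.1 2 (by decide)).trans h2) hp h13 h14 hM hX
      (by omega)).mono le_rfl ?_
    · rwa [hf.2 (by decide)]
    · rintro s'' ⟨hp, h13, h14⟩
      exact ⟨ls, _, by simpa using hl, hp, h13, h14, by rw [← hr]; simp [Bool.or_assoc]⟩
  · rintro s' ⟨⟨ls, r, hl, hp, h13, h14, hr⟩, hf⟩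
    obtain rfl := List.eq_nil_of_length_eq_zero hl
    exact ⟨⟨hp, by rw [h14, ← hr]; simp⟩, hf⟩

/-- A clause as it is presented to the machine. -/
def clauseCode (c : List (Fin n × Bool)) : List ℕ := c.length :: c.map KCNF.litCode

theorem runs_clauseBody (hw : Fits P n m A w) {s : State} (hs : Env P n m A s) {inp : List ℕ}
    (hinp : inp.length ≤ A) (hmem : ∀ i < A, s.mem i = inp.getD i 0) {M X j : ℕ}
    {c : List (Fin n × Bool)} {t : List ℕ} {r : Bool} (h0 : s.reg 0 = M) (h2 : s.reg 2 = X)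
    (hp : inp.drop (s.reg 11) = clauseCode c ++ t) (h12 : s.reg 12 = j + 1)
    (h10 : s.reg 10 = r.toNat) (hM : M < 2 ^ w) (hX : X < 2 ^ w) (hc : c.length ≤ P.q)
    (hj : j < 2 ^ w) :
    Runs w clauseBody s (clauseHead.cost + (P.q * (literalBody.cost + 1) + 1 + clauseTail.cost))
      fun s' => inp.drop (s'.reg 11) = t ∧ s'.reg 12 = j ∧
        s'.reg 10 = (r && c.any (litOK (P.b n) M X)).toNat := by
  have hk := hw.K_lt
  have haddr := hw.addr
  obtain ⟨hp1, hp2, hp3⟩ := drop_eq_cons 0 hp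
  have hload : s.mem (s.reg 11) = c.length := by rw [hmem _ (by omega), hp2]
  have hhead : Runs w clauseHead s clauseHead.cost fun s' =>
      inp.drop (s'.reg 11) = c.map KCNF.litCode ++ t ∧ s'.reg 13 = c.length ∧ s'.reg 14 = 0 := by
    apply Runs.of_wp
    simp [clauseHead, block, wp, State.setReg, BinOp.eval, hs.r21, hload, hp3]
    omega
  refine hhead.frame.seq ?_
  rintro s₁ ⟨⟨h11, h13, h14⟩, hf⟩
  have hs₁ := hs.frame hf (by decide)
  refine ((runs_literals (M := M) (X := X) hw hs₁ hinp ?_ ((hf.1 0 (by decide)).trans h0)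
    ((hf.1 2 (by decide)).trans h2) h11 h13 h14 hM hX (by omega)).mono
    (Nat.add_le_add_right (Nat.mul_le_mul_right _ hc) 1) fun _ h => h).seq ?_
  · rwa [hf.2 (by decide)]
  rintro s₂ ⟨⟨h11, h14⟩, hf₂⟩
  have hs₂ := hs₁.frame hf₂ (by decide)
  have h10' : s₂.reg 10 = r.toNat := by
    rw [hf₂.1 10 (by decide), hf.1 10 (by decide), h10]
  have h12' : s₂.reg 12 = j + 1 := by
    rw [hf₂.1 12 (by decide), hf.1 12 (by decide), h12]
  apply Runs.of_wp
  simp [clauseTail, block, wp, State.setReg, BinOp.eval, hs₂.r21, h10', h12', h11, h14,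
    toNat_and_toNat]
  exact ⟨(Bool.toNat_le _).trans_lt (by omega), hj⟩

theorem runs_clauses (hw : Fits P n m A w) {s : State} (hs : Env P n m A s) {inp : List ℕ}
    (hinp : inp.length ≤ A) (hmem : ∀ i < A, s.mem i = inp.getD i 0) {M X : ℕ}
    {cs : List (List (Fin n × Bool))} (h0 : s.reg 0 = M) (h2 : s.reg 2 = X)
    (hp : inp.drop (s.reg 11) = cs.flatMap clauseCode) (h12 : s.reg 12 = cs.length)
    (h10 : s.reg 10 = 1) (hM : M < 2 ^ w) (hX : X < 2 ^ w) (hcs : ∀ c ∈ cs, c.length ≤ P.q)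
    (hl : cs.length < 2 ^ w) :
    Runs w (loop 12 clauseBody) s (cs.length * (clauseHead.cost +
        (P.q * (literalBody.cost + 1) + 1 + clauseTail.cost) + 1) + 1) fun s' =>
      s'.reg 10 = (cs.all fun c => c.any (litOK (P.b n) M X)).toNat ∧ Frame clauseBody s s' := by
  refine (Runs.loop (m := cs.length) (fun j s' => ∃ (ds : List (List (Fin n × Bool))) (r : Bool),
    ds.length = j ∧ inp.drop (s'.reg 11) = ds.flatMap clauseCode ∧ s'.reg 12 = j ∧
    s'.reg 10 = r.toNat ∧ (∀ c ∈ ds, c.length ≤ P.q) ∧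
    (r && ds.all fun c => c.any (litOK (P.b n) M X)) =
      cs.all fun c => c.any (litOK (P.b n) M X)) ?_ ?_ ?_).mono le_rfl ?_
  · rintro i s' ⟨_, _, _, _, h, _⟩
    exact h
  · exact ⟨cs, true, rfl, hp, h12, h10, hcs, by simp⟩
  · rintro i s' hi ⟨ds, r, hl, hp, h12, h10, hds, hr⟩ hf
    obtain ⟨c, ds, rfl⟩ := List.exists_cons_of_length_eq_add_one hl
    refine (runs_clauseBody (M := M) (X := X) hw (hs.frame hf (by decide)) hinp ?_
      ((hf.1 0 (by decide)).trans h0) ((hf.1 2 (by decide)).trans h2) hp h12 h10 hM hX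
      (hds c (by simp)) (by omega)).mono le_rfl ?_
    · rwa [hf.2 (by decide)]
    · rintro s'' ⟨hp, h12, h10⟩
      exact ⟨ds, _, by simpa using hl, hp, h12, h10, fun d hd => hds d (by simp [hd]),
        by rw [← hr]; simp [Bool.and_assoc]⟩
  · rintro s' ⟨⟨ds, r, hl, hp, h12, h10, -, hr⟩, hf⟩
    obtain rfl := List.eq_nil_of_length_eq_zero hl
    exact ⟨by rw [h10, ← hr]; simp, hf⟩

/-! ### The main loop over all partial assignments. -/

/-- Start processing the next partial assignment. -/
def itemHead : Program := block [
  op .sub 16 16 21, op .mod 0 16 38, op .div 1 16 38,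
  const 2 0, const 3 0, const 4 0, const 5 0, op .add 6 29 20]

/-- Prepare for reading the formula. -/
def checkHead : Program := block [const 10 1, const 11 2, op .add 12 24 20]

/-- Write the number for the present partial assignment to the memory. -/
def writeItem : Program := block [
  -- The result is zero exactly for singletons, the masks that get the complemented moment.
  op .xor 7 4 21, branch 7 .skip (block [op .sub 3 31 3, op .mul 3 34 3]),
  op .mul 7 0 35, op .shiftLeft 7 32 7, op .add 3 3 7, op .add 7 33 17, store 7 3,
  op .add 17 17 21]

/-- Write the number for the present partial assignment to the memory if it is valid. -/
def emit : Program := branch 1 .skip (branch 10 writeItem .skip)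

/-- Process the next partial assignment. -/
def itemBody : Program :=
  .seq itemHead (.seq (loop 6 decodeBody) (.seq checkHead (.seq (loop 12 clauseBody) emit)))

/-- The memory during the main loop. -/
def layout (A : ℕ) (inp l : List ℕ) (i : ℕ) : ℕ :=
  if i < A then inp.getD i 0 else l.getD (i - A) 0

theorem update_layout (A : ℕ) (inp l : List ℕ) (v : ℕ) :
    Function.update (layout A inp l) (A + l.length) v = layout A inp (l ++ [v]) := by
  funext i
  rw [Function.update_apply]
  unfold layout
  split_ifs with h1 h2 h2
  · omega
  · subst h1; simp
  · rfl
  · rcases lt_or_gt_of_ne (show i - A ≠ l.length by omega) with h | h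
    · rw [List.getD_append _ _ _ _ h]
    · rw [List.getD_eq_default _ _ h.le, List.getD_eq_default]
      simp; omega

theorem Params.Good.value_lt (hP : P.Good) (hw : Fits P n m A w) {M e : ℕ}
    (hM : M < 2 ^ P.K) :
    P.low n M e + P.top n * 2 ^ (M * P.ell) < 2 ^ w ∧
      P.top n * 2 ^ (M * P.ell) ≤ P.low n M e + P.top n * 2 ^ (M * P.ell) := by
  have h1 : P.top n * 2 ^ (M * P.ell) ≤ P.top n * 2 ^ (2 ^ P.K * P.ell) :=
    Nat.mul_le_mul_left _ (Nat.pow_le_pow_right (by norm_num) (Nat.mul_le_mul_right _ hM.le))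
  have h2 : P.low n M e ≤ P.lam * P.cap n + P.cap n := by
    have := hP.V_lt (n := n) M e
    unfold Params.low
    split_ifs
    · exact (Nat.mul_le_mul_left _ (Nat.sub_le _ _)).trans (Nat.le_add_right _ _)
    · omega
  have := hw.value
  omega

theorem runs_emit (hP : P.Good) (hw : Fits P n m A w) {s : State} (hs : Env P n m A s)
    {M e : ℕ} {r : Bool} {inp l : List ℕ} (hM : M < 2 ^ P.K) (hl : l.length < P.total n)
    (h0 : s.reg 0 = M) (h1 : s.reg 1 = e / (2 ^ P.b n) ^ cnt M P.K) (h3 : s.reg 3 = P.V n M e)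
    (h4 : s.reg 4 = cnt M P.K) (h10 : s.reg 10 = r.toNat) (h17 : s.reg 17 = l.length)
    (hmem : s.mem = layout A inp l) :
    Runs w emit s emit.cost fun s' =>
      s'.mem = layout A inp (l ++
        if e / (2 ^ P.b n) ^ cnt M P.K = 0 ∧ r then [P.value n M e] else []) ∧
      s'.reg 17 = (l ++
        if e / (2 ^ P.b n) ^ cnt M P.K = 0 ∧ r then [P.value n M e] else []).length := by
  apply Runs.of_wp
  by_cases hr : e / (2 ^ P.b n) ^ cnt M P.K = 0
  · cases r
    · simp only [emit, wp, h1, h10, hr]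
      simp [hmem, h17]
    · have hk := hw.K_lt
      have haddr := hw.addr
      have hexp := hw.exponent
      have hval := hP.value_lt hw (e := e) hM
      have hKt := two_pow_K_le_total (P := P) (n := n)
      have hV := hP.V_lt (n := n) M e
      have hc := cnt_le M P.K
      have hwval := hw.value
      have hMl : M * P.ell ≤ 2 ^ P.K * P.ell := Nat.mul_le_mul_right _ hM.le
      have hx : cnt M P.K ^^^ 1 < 2 ^ w := Nat.xor_lt_two_pow (by omega) (by omega)
      have hx1 : cnt M P.K ^^^ 1 = 0 ↔ cnt M P.K = 1 := Nat.xor_eq_zero_iff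
      simp only [emit, wp, h1, h10, hr]
      by_cases hcnt : cnt M P.K = 1
      · have hlow : P.low n M e = P.lam * (P.cap n - P.V n M e) := if_pos hcnt
        simp [writeItem, block, wp, State.setReg, State.setMem, BinOp.eval, hs.r21, hs.r31, hs.r32,
          hs.r33, hs.r34, hs.r35, h0, h3, h4, h17, hcnt, hmem, Nat.shiftLeft_eq, update_layout,
          ← hlow]
        exact ⟨by omega, by omega, by omega, by omega, by omega, by omega, by omega, rfl⟩
      · have hlow : P.low n M e = P.V n M e := if_neg hcnt
        simp [writeItem, block, wp, State.setReg, State.setMem, BinOp.eval, hs.r21, hs.r31, hs.r32,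
          hs.r33, hs.r34, hs.r35, h0, h3, h4, h17, hx1, hcnt, hmem, Nat.shiftLeft_eq, update_layout,
          ← hlow]
        exact ⟨hx, by omega, by omega, by omega, by omega, by omega, rfl⟩
  · simp only [emit, wp, h1, h10]
    simp [hmem, h17, hr]

theorem valid_iff {k : ℕ} (φ : KCNF k) (M e : ℕ) : P.Valid φ M e ↔
    e / (2 ^ P.b φ.numVars) ^ cnt M P.K = 0 ∧ (φ.clauses.all fun c =>
      c.any (litOK (P.b φ.numVars) M (word (P.b φ.numVars) M e P.K))) := by
  simp only [Params.Valid, Params.Passes, List.all_eq_true, List.any_eq_true, litOK_iff]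

/-- The main loop counts its index down and appends to the output. This is why `items` lists the
indices in decreasing order. -/
theorem items_eq {k : ℕ} (φ : KCNF k) {i : ℕ} (hi : i < P.total φ.numVars) :
    P.items φ i = P.items φ (i + 1) ++
      if (i / 2 ^ P.K) / (2 ^ P.b φ.numVars) ^ cnt (i % 2 ^ P.K) P.K = 0 ∧
        (φ.clauses.all fun c => c.any (litOK (P.b φ.numVars) (i % 2 ^ P.K)
          (word (P.b φ.numVars) (i % 2 ^ P.K) (i / 2 ^ P.K) P.K)))
      then [P.value φ.numVars (i % 2 ^ P.K) (i / 2 ^ P.K)] else [] := by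
  classical
  unfold Params.items
  rw [List.drop_eq_getElem_cons (by simpa using hi), List.reverse_cons, List.filter_append,
    List.map_append]
  congr 1
  simp only [List.getElem_range, List.filter_cons, List.filter_nil, decide_eq_true_eq, valid_iff]
  split_ifs <;> simp

/-- A bound for the time spent on one partial assignment. -/
def itemTime (P : Params) (m : ℕ) : ℕ :=
  itemHead.cost + (P.K * (decodeBody.cost + 1) + 1 + (checkHead.cost +
    (m * (clauseHead.cost + (P.q * (literalBody.cost + 1) + 1 + clauseTail.cost) + 1) + 1 +
    emit.cost)))

theorem word_lt (hP : P.Good) (hw : Fits P n m A w) (M e : ℕ) : word (P.b n) M e P.K < 2 ^ w := by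
  have h1 := word_le_moment (b := P.b n) (f := P.f n) (h := P.f n * P.K) (M := M) (e := e)
    (g := P.K) (Nat.le_add_right _ _)
  have h2 := hP.V_lt (n := n) M e
  have h3 := hw.value
  unfold Params.V at h2
  omega

theorem input_drop_two {k : ℕ} (φ : KCNF k) : φ.input.drop 2 = φ.clauses.flatMap clauseCode := rfl

theorem runs_itemBody {q : ℕ} {P : Params} (hP : P.Good) (hq : q = P.q) {φ : KCNF q}
    (hw : Fits P φ.numVars φ.clauses.length A w)
    (hinp : φ.input.length ≤ A) {s : State} (hs : Env P φ.numVars φ.clauses.length A s) {i : ℕ}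
    (hi : i < P.total φ.numVars) (h16 : s.reg 16 = i + 1)
    (h17 : s.reg 17 = (P.items φ (i + 1)).length)
    (hmem : s.mem = layout A φ.input (P.items φ (i + 1))) :
    Runs w itemBody s (itemTime P φ.clauses.length) fun s' => s'.reg 16 = i ∧
      s'.reg 17 = (P.items φ i).length ∧ s'.mem = layout A φ.input (P.items φ i) := by
  have hk := hw.K_lt
  have haddr := hw.addr
  have haddr_eq := hw.addr_eq
  have hm : φ.clauses.length ≤ A := by
    rw [haddr_eq]
    have : φ.clauses.length ≤ φ.clauses.length * (P.q + 1) :=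
      Nat.le_mul_of_pos_right _ (Nat.succ_pos _)
    omega
  have hKt := two_pow_K_le_total (P := P) (n := φ.numVars)
  have hM : i % 2 ^ P.K < 2 ^ P.K := Nat.mod_lt _ (by positivity)
  have he : i / 2 ^ P.K ≤ i := Nat.div_le_self _ _
  have hhead : Runs w itemHead s itemHead.cost fun s' => s'.reg 16 = i ∧ s'.reg 0 = i % 2 ^ P.K ∧
      s'.reg 1 = i / 2 ^ P.K ∧ s'.reg 2 = 0 ∧ s'.reg 3 = 0 ∧ s'.reg 4 = 0 ∧ s'.reg 5 = 0 ∧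
      s'.reg 6 = P.K := by
    apply Runs.of_wp
    simp [itemHead, block, wp, State.setReg, BinOp.eval, hs.r21, hs.r38, hs.r29, hs.r20, h16]
    omega
  refine (hhead.frame.seq (Q' := fun s' => s'.reg 16 = i ∧
      s'.reg 17 = (P.items φ i).length ∧ s'.mem = layout A φ.input (P.items φ i)) ?_)
  rintro s₁ ⟨⟨h16₁, h0₁, h1₁, h2₁, h3₁, h4₁, h5₁, h6₁⟩, hf₁⟩
  have hs₁ := hs.frame hf₁ (by decide)
  refine (runs_decode hP hw hs₁ hM (by omega) h0₁ h1₁ h2₁ h3₁ h4₁ h5₁ h6₁).seq ?_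
  rintro s₂ ⟨⟨h1₂, h2₂, h3₂, h4₂⟩, hf₂⟩
  have hs₂ := hs₁.frame hf₂ (by decide)
  have hcheck : Runs w checkHead s₂ checkHead.cost fun s' => s'.reg 10 = 1 ∧ s'.reg 11 = 2 ∧
      s'.reg 12 = φ.clauses.length := by
    apply Runs.of_wp
    simp [checkHead, block, wp, State.setReg, BinOp.eval, hs₂.r20, hs₂.r24]
    exact ⟨by rintro rfl; omega, by omega, by omega⟩
  refine hcheck.frame.seq ?_
  rintro s₃ ⟨⟨h10₃, h11₃, h12₃⟩, hf₃⟩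
  have hs₃ := hs₂.frame hf₃ (by decide)
  have hmem₃ : s₃.mem = layout A φ.input (P.items φ (i + 1)) := by
    rw [hf₃.2 (by decide), hf₂.2 (by decide), hf₁.2 (by decide), hmem]
  have h0₃ : s₃.reg 0 = i % 2 ^ P.K := by
    rw [hf₃.1 0 (by decide), hf₂.1 0 (by decide), h0₁]
  have h2₃ := (hf₃.1 2 (by decide)).trans h2₂
  refine (runs_clauses (cs := φ.clauses) hw hs₃ hinp (fun j hj => ?_) h0₃ h2₃ ?_ h12₃ h10₃
    (by omega) (word_lt hP hw _ _) (fun c hc => hq ▸ φ.length_le c hc) (by omega)).seq ?_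
  · rw [hmem₃, layout, if_pos hj]
  · rw [h11₃, input_drop_two]
  rintro s₄ ⟨h10₄, hf₄⟩
  have hs₄ := hs₃.frame hf₄ (by decide)
  have hl := P.length_items_le φ (i + 1)
  refine (runs_emit (e := i / 2 ^ P.K) (inp := φ.input) (l := P.items φ (i + 1)) hP hw hs₄ hM
    (by omega) ?_ ?_ ?_ ?_ h10₄ ?_ ?_).frame.mono le_rfl ?_
  · rw [hf₄.1 0 (by decide), h0₃]
  · rw [hf₄.1 1 (by decide), hf₃.1 1 (by decide), h1₂]
  · rw [hf₄.1 3 (by decide), hf₃.1 3 (by decide), h3₂]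
  · rw [hf₄.1 4 (by decide), hf₃.1 4 (by decide), h4₂]
  · rw [hf₄.1 17 (by decide), hf₃.1 17 (by decide), hf₂.1 17 (by decide), hf₁.1 17 (by decide), h17]
  · rw [hf₄.2 (by decide), hmem₃]
  · rintro s₅ ⟨⟨hmem₅, h17₅⟩, hf₅⟩
    rw [← items_eq φ hi] at hmem₅ h17₅
    refine ⟨?_, h17₅, hmem₅⟩
    rw [hf₅.1 16 (by decide), hf₄.1 16 (by decide), hf₃.1 16 (by decide), hf₂.1 16 (by decide),
      h16₁]

theorem runs_items {q : ℕ} {P : Params} (hP : P.Good) (hq : q = P.q) {φ : KCNF q}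
    (hw : Fits P φ.numVars φ.clauses.length A w)
    (hinp : φ.input.length ≤ A) {s : State} (hs : Env P φ.numVars φ.clauses.length A s)
    (h16 : s.reg 16 = P.total φ.numVars) (h17 : s.reg 17 = 0)
    (hmem : s.mem = layout A φ.input []) :
    Runs w (loop 16 itemBody) s
      (P.total φ.numVars * (itemTime P φ.clauses.length + 1) + 1) fun s' =>
      (s'.reg 17 = (P.items φ 0).length ∧ s'.mem = layout A φ.input (P.items φ 0)) ∧
      Env P φ.numVars φ.clauses.length A s' := by
  have h0 : P.items φ (P.total φ.numVars) = [] := by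
    rw [← List.length_eq_zero_iff]
    have := P.length_items_le φ (P.total φ.numVars)
    omega
  refine (Runs.loop (m := P.total φ.numVars) (fun i s' => s'.reg 16 = i ∧
    s'.reg 17 = (P.items φ i).length ∧ s'.mem = layout A φ.input (P.items φ i))
    (fun i s' h => h.1) ⟨h16, by rw [h0, h17]; rfl, by rw [h0, hmem]⟩ ?_).mono le_rfl ?_
  · rintro i s' hi ⟨h16, h17, hmem⟩ hf
    exact runs_itemBody hP hq hw hinp (hs.frame hf (by decide)) hi h16 h17 hmem
  · rintro s' ⟨⟨-, h17, hmem⟩, hf⟩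
    exact ⟨⟨h17, hmem⟩, hs.frame hf (by decide)⟩

/-! ### Setting up, and assembling the start state of the `k`-Sum instance. -/

/-- Compute the parameters of the reduction. -/
def setup (P : Params) : Program := block [
  -- Register `20` still has its initial value `0`, so the first load reads the number of variables.
  load 23 20, const 21 1, load 24 21, const 22 2, const 29 P.K,
  op .div 25 23 29, op .add 25 25 21, op .shiftLeft 26 21 25,
  const 35 P.ell, op .add 27 25 35, op .mul 28 27 29,
  const 7 (P.K + 2), op .mul 7 7 25, op .shiftLeft 30 21 7,
  const 7 (2 ^ ((P.K + 1) * P.ell)), op .mul 31 30 7,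
  const 7 (2 ^ ((P.K + 3) * P.ell)), op .mul 32 30 7,
  const 34 P.lam, const 38 (2 ^ P.K),
  const 7 P.q, op .mul 7 7 25, op .shiftLeft 7 21 7, op .mul 16 7 38,
  const 7 (P.q + 1), op .mul 7 24 7, op .add 33 7 16, const 7 3, op .add 33 33 7]

/-- Erase one memory cell. -/
def clearBody : Program := block [op .sub 0 0 21, store 0 20]

/-- Erase the formula. -/
def clear : Program := .seq (op .add 0 33 20) (loop 0 clearBody)

/-- Move one number to its final place. -/
def moveBody : Program := block [
  op .sub 0 0 21, op .add 2 33 0, load 3 2, store 2 20, op .add 2 1 0, store 2 3]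

/-- Start moving numbers. -/
def moveHead : Program := block [op .add 0 17 20, const 1 3]

/-- Move the numbers to their final place. -/
def move : Program := .seq moveHead (loop 0 moveBody)

/-- Write the first three entries of the `k`-Sum instance. -/
def header (P : Params) : Program := block [
  store 20 17, const 7 P.Uc, op .mul 7 30 7, store 21 7,
  const 7 P.Tc, op .mul 7 30 7, store 22 7]

/-- Set the first registers to `0`. -/
def resetRegs : ℕ → Program
  | 0 => .skip
  | r + 1 => .seq (resetRegs r) (const r 0)

/-- Replace a formula by a `k`-Sum instance. -/
def reduce (P : Params) : Program :=
  .seq (setup P) (.seq (loop 16 itemBody) (.seq clear (.seq move (.seq (header P) (resetRegs 40)))))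

theorem Fits.const_lt (h : Fits P n m A w) : P.lam < 2 ^ w ∧ P.ell < 2 ^ w ∧ P.Uc < 2 ^ w ∧
    P.Tc < 2 ^ w ∧ 2 ^ P.K < 2 ^ w ∧ 2 ^ ((P.K + 1) * P.ell) < 2 ^ w ∧
    2 ^ ((P.K + 3) * P.ell) < 2 ^ w := by
  have := h.const
  generalize 2 ^ P.K = a at *
  generalize 2 ^ ((P.K + 1) * P.ell) = b at *
  generalize 2 ^ ((P.K + 3) * P.ell) = c at *
  omega

theorem runs_setup {q : ℕ} {P : Params} (hP : P.Good) {φ : KCNF q}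
    (hw : Fits P φ.numVars φ.clauses.length A w) (hinp : φ.input.length ≤ A) :
    Runs w (setup P) (startState φ.input) (setup P).cost fun s' =>
      Env P φ.numVars φ.clauses.length A s' ∧ s'.reg 16 = P.total φ.numVars ∧ s'.reg 17 = 0 ∧
      s'.mem = layout A φ.input [] := by
  have hk := hw.K_lt
  obtain ⟨hc1, hc2, -, -, hc5, hc6, hc7⟩ := hw.const_lt
  have hcode := hw.code
  have haddr := hw.addr
  have hA := hw.addr_eq
  have hexp := hw.exponent
  have hval := hw.value
  have hlay : (fun i => φ.input.getD i 0) = layout A φ.input [] := by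
    funext i
    unfold layout
    split_ifs with h
    · rfl
    · rw [List.getD_eq_default _ _ (by omega)]; rfl
  have h0 : φ.input.getD 0 0 = φ.numVars := rfl
  have h1 : φ.input[1]?.getD 0 = φ.clauses.length := rfl
  have htot : 2 ^ (P.q * P.b φ.numVars) * 2 ^ P.K = P.total φ.numVars := rfl
  have hb : φ.numVars / P.K + 1 = P.b φ.numVars := rfl
  have hf : P.b φ.numVars + P.ell = P.f φ.numVars := rfl
  have hG : 2 ^ ((P.K + 2) * P.b φ.numVars) = P.scale φ.numVars := rfl
  have hcap : P.scale φ.numVars * 2 ^ ((P.K + 1) * P.ell) = P.cap φ.numVars := rfl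
  have htop : P.scale φ.numVars * 2 ^ ((P.K + 3) * P.ell) = P.top φ.numVars := rfl
  apply Runs.of_wp
  simp only [setup, block, wp, startState, State.setReg, BinOp.eval, Function.update_apply, h0]
  simp [Nat.shiftLeft_eq, htot, hb, hf, hG, hcap, htop, h1]
  simp only [List.getD_eq_getElem?_getD] at hlay
  have hKpos := hP.K_pos
  have hlen : φ.clauses.length ≤ φ.clauses.length * (P.q + 1) :=
    Nat.le_mul_of_pos_right _ (Nat.succ_pos _)
  have hn := Nat.div_le_self φ.numVars P.K
  have hscale : P.scale φ.numVars ≤ P.cap φ.numVars :=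
    Nat.le_mul_of_pos_right _ (by positivity)
  have hd : 2 ^ P.b φ.numVars ≤ P.scale φ.numVars :=
    Nat.pow_le_pow_right (by norm_num) (Nat.le_mul_of_pos_left _ (by omega))
  have hfK : P.f φ.numVars ≤ P.f φ.numVars * P.K := Nat.le_mul_of_pos_right _ hKpos
  have htop' : P.top φ.numVars ≤ P.top φ.numVars * 2 ^ (2 ^ P.K * P.ell) :=
    Nat.le_mul_of_pos_right _ (by positivity)
  have hqb : 2 ^ (P.q * P.b φ.numVars) ≤ P.total φ.numVars :=
    Nat.le_mul_of_pos_right _ (by positivity)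
  refine ⟨by omega, by rintro rfl; omega, by omega, by omega, by omega, by omega, by omega,
    by omega, hc2, by omega, by omega, by omega, by omega, by omega, hc6, by omega, hc7, by omega,
    hc1, hc5, by omega, by omega, by omega, by omega, by omega, by omega, by omega, by omega,
    by omega, ?_, hlay⟩
  constructor <;> simp [hA]

theorem runs_clear {inp l : List ℕ} (hA : A < 2 ^ w) {s : State} (hs : Env P n m A s)
    (hmem : s.mem = layout A inp l) :
    Runs w clear s (1 + (A * (clearBody.cost + 1) + 1)) fun s' =>
      s'.mem = layout A [] l ∧ Env P n m A s' ∧ s'.reg 17 = s.reg 17 := by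
  have h1 : Runs w (op .add 0 33 20) s 1 fun s' => s'.reg 0 = A := by
    apply Runs.of_wp
    simpa [wp, State.setReg, BinOp.eval, hs.r33, hs.r20] using hA
  refine h1.frame.seq ?_
  rintro s₁ ⟨h0, hf₁⟩
  have hs₁ := hs.frame hf₁ (by decide)
  -- The cells are erased from address `A - 1` downwards; those from the counter up to `A` are
  -- already zero.
  refine (Runs.loop (m := A) (fun j s' => s'.reg 0 = j ∧
    s'.mem = fun i => if i < j ∨ A ≤ i then layout A inp l i else 0) (fun i s' h => h.1)
    ⟨h0, ?_⟩ ?_).mono le_rfl ?_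
  · rw [hf₁.2 rfl, hmem]
    funext i
    rw [if_pos (by omega)]
  · rintro j s' hj ⟨h0, hm⟩ hf
    have hs' := hs₁.frame hf (by decide)
    apply Runs.of_wp
    simp [clearBody, block, wp, State.setReg, State.setMem, BinOp.eval, hs'.r20, hs'.r21, h0]
    refine ⟨by omega, ?_⟩
    funext i
    rw [Function.update_apply, hm]
    grind
  · rintro s' ⟨⟨-, hm⟩, hf⟩
    refine ⟨?_, hs₁.frame hf (by decide), ?_⟩
    · rw [hm]
      funext i
      unfold layout
      simp
      grind
    · rw [hf.1 17 (by decide), hf₁.1 17 (by decide)]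

/-- The memory while the numbers are moved. -/
def moveLayout (A : ℕ) (l : List ℕ) (j i : ℕ) : ℕ :=
  if i < 3 + j then 0 else if i < 3 + l.length then l.getD (i - 3) 0 else
    if i < A then 0 else if i < A + j then l.getD (i - A) 0 else 0

/-- The first bound keeps the source, from `A` on, disjoint from the destination, from `3` on. Each
source cell is erased as it is read, so no trace remains. -/
theorem runs_move {l : List ℕ} (hA : 3 + l.length ≤ A) (hw : A + l.length < 2 ^ w) {s : State}
    (hs : Env P n m A s) (hl : ∀ z ∈ l, z < 2 ^ w) (h17 : s.reg 17 = l.length)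
    (hmem : s.mem = layout A [] l) :
    Runs w move s (moveHead.cost + (l.length * (moveBody.cost + 1) + 1)) fun s' =>
      s'.mem = moveLayout A l 0 ∧ Env P n m A s' ∧ s'.reg 17 = l.length := by
  have h1 : Runs w moveHead s moveHead.cost fun s' => s'.reg 0 = l.length ∧ s'.reg 1 = 3 := by
    apply Runs.of_wp
    simp [moveHead, block, wp, State.setReg, BinOp.eval, hs.r20, h17]
    omega
  refine h1.frame.seq ?_
  rintro s₁ ⟨⟨h0, h1⟩, hf₁⟩
  have hs₁ := hs.frame hf₁ (by decide)
  refine (Runs.loop (m := l.length) (fun j s' => s'.reg 0 = j ∧ s'.mem = moveLayout A l j)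
    (fun i s' h => h.1) ⟨h0, ?_⟩ ?_).mono le_rfl ?_
  · rw [hf₁.2 (by decide), hmem]
    funext i
    unfold layout moveLayout
    simp
    grind
  · rintro j s' hj ⟨h0, hm⟩ hf
    have hs' := hs₁.frame hf (by decide)
    have h1' := (hf.1 1 (by decide)).trans h1
    have hload : s'.mem (A + j) = l.getD j 0 := by
      rw [hm]
      unfold moveLayout
      split_ifs <;> first | omega | simp
    have hlj : l.getD j 0 < 2 ^ w := by
      rw [List.getD_eq_getElem _ _ hj]
      exact hl _ (List.getElem_mem _)
    apply Runs.of_wp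
    rw [List.getD_eq_getElem?_getD] at hlj
    simp [moveBody, block, wp, State.setReg, State.setMem, BinOp.eval, hs'.r20, hs'.r21, hs'.r33,
      h0, h1', hload]
    refine ⟨by omega, by omega, hlj, by omega, ?_⟩
    funext i
    simp only [Function.update_apply, hm, moveLayout]
    grind
  · rintro s' ⟨⟨-, hm⟩, hf⟩
    exact ⟨hm, hs₁.frame hf (by decide), by
      rw [hf.1 17 (by decide), hf₁.1 17 (by decide), h17]⟩

theorem runs_header {l : List ℕ} (hw : Fits P n m A w) {s : State}
    (hs : Env P n m A s) (h17 : s.reg 17 = l.length) (hmem : s.mem = moveLayout A l 0) :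
    Runs w (header P) s (header P).cost fun s' =>
      s'.mem = (startState (l.length :: P.scale n * P.Uc :: P.scale n * P.Tc :: l)).mem := by
  obtain ⟨-, -, hc3, hc4, -⟩ := hw.const_lt
  have hh := hw.header
  apply Runs.of_wp
  simp [header, block, wp, State.setReg, State.setMem, BinOp.eval, hs.r20, hs.r21, hs.r22, hs.r30,
    h17]
  refine ⟨hc3, by omega, hc4, by omega, ?_⟩
  rw [hmem]
  funext i
  rcases i with _ | _ | _ | i
  · simp [startState]
  · simp [startState]
  · simp [startState]
  · simp [startState, moveLayout]
    grind

theorem runs_resetRegs (k : ℕ) (s : State) : Runs w (resetRegs k) s (k + 1) fun s' =>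
    (∀ r < k, s'.reg r = 0) ∧ s'.mem = s.mem := by
  induction k with
  | zero => exact ⟨1, s, .skip s, by omega, by simp, rfl⟩
  | succ k ih =>
    refine ih.seq (t' := 1) fun s' ⟨h1, h2⟩ => Runs.of_wp (p := const k 0) ?_
    refine ⟨by positivity, fun r hr => ?_, h2⟩
    simp only [State.setReg, Function.update_apply]
    split_ifs with h
    · rfl
    · exact h1 r (by omega)

/-- A bound for the time of the reduction. -/
def reduceTime (P : Params) (m A t : ℕ) : ℕ :=
  (setup P).cost + (t * (itemTime P m + 1) + 1 + (1 + (A * (clearBody.cost + 1) + 1) +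
    (moveHead.cost + (t * (moveBody.cost + 1) + 1) + ((header P).cost + 41))))

theorem items_lt (hP : P.Good) {q : ℕ} {φ : KCNF q} (hw : Fits P φ.numVars m A w) :
    ∀ z ∈ P.items φ 0, z < 2 ^ w := by
  intro z hz
  obtain ⟨M, hM, e, -, -, rfl⟩ := Params.mem_items.1 hz
  exact (hP.value_lt hw hM).1

/-- The final state must equal the start state literally, since nothing is known about what the
appended `k`-Sum program reads. Memory is cleaned explicitly, the registers below `40` are reset,
and the others are never written. -/
theorem runs_reduce {q : ℕ} {P : Params} (hP : P.Good) (hq : q = P.q) {φ : KCNF q}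
    (hw : Fits P φ.numVars φ.clauses.length A w) (hinp : φ.input.length ≤ A) :
    Runs w (reduce P) (startState φ.input)
      (reduceTime P φ.clauses.length A (P.total φ.numVars)) fun s' =>
      s' = startState ((P.items φ 0).length :: P.scale φ.numVars * P.Uc ::
        P.scale φ.numVars * P.Tc :: P.items φ 0) := by
  have hl := P.length_items_le φ 0
  have haddr := hw.addr
  have haddr_eq := hw.addr_eq
  have h : Runs w (reduce P) (startState φ.input)
      (reduceTime P φ.clauses.length A (P.total φ.numVars)) fun s' =>
      (∀ r < 40, s'.reg r = 0) ∧ s'.mem = (startState ((P.items φ 0).length ::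
        P.scale φ.numVars * P.Uc :: P.scale φ.numVars * P.Tc :: P.items φ 0)).mem := by
    refine (runs_setup hP hw hinp).seq ?_
    rintro s₁ ⟨hs₁, h16, h17, hmem⟩
    refine (runs_items hP hq hw hinp hs₁ h16 h17 hmem).seq ?_
    rintro s₂ ⟨⟨h17₂, hmem₂⟩, hs₂⟩
    refine (runs_clear (by omega) hs₂ hmem₂).seq ?_
    rintro s₃ ⟨hmem₃, hs₃, h17₃⟩
    refine ((runs_move (by omega) (by omega) hs₃ (items_lt hP hw) (h17₃.trans h17₂)
      hmem₃).mono (t' := moveHead.cost + (P.total φ.numVars * (moveBody.cost + 1) + 1))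
      (by gcongr; omega) fun _ h => h).seq ?_
    rintro s₄ ⟨hmem₄, hs₄, h17₄⟩
    refine (runs_header hw hs₄ h17₄ hmem₄).seq ?_
    rintro s₅ hmem₅
    exact (runs_resetRegs 40 s₅).mono le_rfl fun s₆ ⟨h1, h2⟩ => ⟨h1, h2.trans hmem₅⟩
  refine h.frame.mono le_rfl ?_
  rintro s' ⟨⟨h1, h2⟩, hf⟩
  ext i
  · by_cases hi : i < 40
    · exact h1 i hi
    · have h3 : ∀ r ∈ (reduce P).writes, r < 40 := by
        simp [reduce, setup, itemBody, itemHead, decodeBody, addDigit, checkHead, clauseBody,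
          clauseHead, literalBody, clauseTail, emit, writeItem, clear, clearBody, move, moveHead,
          moveBody, header, block, Program.writes, resetRegs]
      exact hf.1 i fun h4 => hi (h3 i h4)
  · rw [h2]

open Filter

/-! ### Bounds on the size of a formula -/

/-- A list of length at most `q` is determined by its entries at the positions below `q`, with
`none` past the end, so there are at most as many lists as functions `Fin q → Option α`. -/
theorem length_le_of_nodup {α : Type*} [Fintype α] {q : ℕ} {l : List (List α)} (hl : l.Nodup)
    (hq : ∀ c ∈ l, c.length ≤ q) : l.length ≤ (Fintype.card α + 1) ^ q := by
  let f : List α → Fin q → Option α := fun x i => x[(i : ℕ)]?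
  have hf : (l.map f).Nodup := by
    refine hl.map_on fun c hc d hd h => List.ext_getElem? fun i => ?_
    by_cases hi : i < q
    · exact congrFun h ⟨i, hi⟩
    · have h1 := hq c hc
      have h2 := hq d hd
      rw [List.getElem?_eq_none (by omega), List.getElem?_eq_none (by omega)]
  simpa using hf.length_le_card

theorem length_clauses_le {q : ℕ} (φ : KCNF q) :
    φ.clauses.length ≤ (2 * φ.numVars + 1) ^ q := by
  simpa [mul_comm] using length_le_of_nodup φ.nodup φ.length_le

theorem length_input_le {q : ℕ} (φ : KCNF q) :
    φ.input.length ≤ φ.clauses.length * (q + 1) + 2 := by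
  have h : ∀ cs : List (List (Fin φ.numVars × Bool)), (∀ c ∈ cs, c.length ≤ q) →
      (cs.flatMap clauseCode).length ≤ cs.length * (q + 1) := by
    intro cs
    induction cs with
    | nil => simp
    | cons c cs ih =>
      intro h
      have h1 := h c (by simp)
      have h2 := ih fun d hd => h d (by simp [hd])
      rw [List.flatMap_cons, List.length_append, List.length_cons, Nat.succ_mul]
      simp only [clauseCode, List.length_cons, List.length_map]
      omega
  exact Nat.add_le_add_right (h φ.clauses φ.length_le) 2

/-- `g` is at most linear in the number of variables. -/
def LinBdd {q : ℕ} (g : KCNF q → ℕ) : Prop := ∃ a, ∀ φ, g φ ≤ a * (φ.numVars + 1)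

/-- `g` is at most exponential in the number of variables. -/
def ExpBdd {q : ℕ} (g : KCNF q → ℕ) : Prop := ∃ c, ∀ φ, g φ < 2 ^ (c * (φ.numVars + 1))

section

variable {q : ℕ} {g h : KCNF q → ℕ}

theorem LinBdd.const (a : ℕ) : LinBdd fun _ : KCNF q => a :=
  ⟨a, fun _ => Nat.le_mul_of_pos_right _ (Nat.succ_pos _)⟩

theorem LinBdd.numVars : LinBdd fun φ : KCNF q => φ.numVars := ⟨1, fun φ => by
  rw [one_mul]; exact Nat.le_succ φ.numVars⟩

theorem LinBdd.add (hg : LinBdd g) (hh : LinBdd h) : LinBdd fun φ => g φ + h φ := by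
  obtain ⟨a, ha⟩ := hg
  obtain ⟨b, hb⟩ := hh
  exact ⟨a + b, fun φ => by rw [add_mul]; exact Nat.add_le_add (ha φ) (hb φ)⟩

theorem LinBdd.const_mul (a : ℕ) (hg : LinBdd g) : LinBdd fun φ => a * g φ := by
  obtain ⟨b, hb⟩ := hg
  exact ⟨a * b, fun φ => by rw [mul_assoc]; exact Nat.mul_le_mul_left _ (hb φ)⟩

theorem LinBdd.mul_const (hg : LinBdd g) (a : ℕ) : LinBdd fun φ => g φ * a := by
  simpa only [mul_comm] using hg.const_mul a

theorem ExpBdd.mono (hh : ExpBdd h) (hgh : ∀ φ, g φ ≤ h φ) : ExpBdd g := by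
  obtain ⟨c, hc⟩ := hh
  exact ⟨c, fun φ => (hgh φ).trans_lt (hc φ)⟩

theorem LinBdd.two_pow (hg : LinBdd g) : ExpBdd fun φ => 2 ^ g φ := by
  obtain ⟨a, ha⟩ := hg
  refine ⟨a + 1, fun φ => Nat.pow_lt_pow_right (by norm_num) ?_⟩
  rw [Nat.succ_mul]
  have := ha φ
  omega

theorem LinBdd.expBdd (hg : LinBdd g) : ExpBdd g :=
  hg.two_pow.mono fun _ => Nat.lt_two_pow_self.le

theorem ExpBdd.mul (hg : ExpBdd g) (hh : ExpBdd h) : ExpBdd fun φ => g φ * h φ := by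
  obtain ⟨a, ha⟩ := hg
  obtain ⟨b, hb⟩ := hh
  refine ⟨a + b, fun φ => ?_⟩
  rw [add_mul, pow_add]
  exact Nat.mul_lt_mul'' (ha φ) (hb φ)

theorem ExpBdd.const (a : ℕ) : ExpBdd fun _ : KCNF q => a := (LinBdd.const a).expBdd

theorem ExpBdd.add (hg : ExpBdd g) (hh : ExpBdd h) : ExpBdd fun φ => g φ + h φ := by
  obtain ⟨a, ha⟩ := hg
  obtain ⟨b, hb⟩ := hh
  refine ⟨a + b, fun φ => ?_⟩
  have h1 : (g φ + 1) * (h φ + 1) ≤ _ := Nat.mul_le_mul (ha φ) (hb φ)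
  rw [add_mul, pow_add]
  nlinarith

theorem ExpBdd.pow (hg : ExpBdd g) (k : ℕ) : ExpBdd fun φ => g φ ^ k := by
  induction k with
  | zero => exact ExpBdd.const 1
  | succ k ih => exact (ih.mul hg).mono fun φ => (pow_succ _ _).le

theorem ExpBdd.eventually (hg : ExpBdd g) :
    ∀ᶠ c in atTop, ∀ φ, g φ < 2 ^ (c * (φ.numVars + 1)) := by
  obtain ⟨a, ha⟩ := hg
  filter_upwards [eventually_ge_atTop a] with c hc φ
  exact (ha φ).trans_le (Nat.pow_le_pow_right (by norm_num) (Nat.mul_le_mul_right _ hc))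

end

theorem LinBdd.b {q : ℕ} (P : Params) : LinBdd fun φ : KCNF q => P.b φ.numVars :=
  ⟨1, fun φ => by rw [one_mul]; exact Nat.succ_le_succ (Nat.div_le_self _ _)⟩

theorem ExpBdd.scale {q : ℕ} (P : Params) : ExpBdd fun φ : KCNF q => P.scale φ.numVars :=
  ((LinBdd.b P).const_mul _).two_pow

theorem ExpBdd.total {q : ℕ} (P : Params) : ExpBdd fun φ : KCNF q => P.total φ.numVars :=
  ((LinBdd.b P).const_mul _).two_pow.mul (.const _)

theorem ExpBdd.length_clauses {q : ℕ} : ExpBdd fun φ : KCNF q => φ.clauses.length :=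
  ((((LinBdd.numVars.const_mul 2).add (.const 1)).expBdd).pow q).mono length_clauses_le

/-- The address at which the reduction collects the numbers. -/
def base (P : Params) {q : ℕ} (φ : KCNF q) : ℕ :=
  φ.clauses.length * (P.q + 1) + P.total φ.numVars + 3

/-- Every requirement on the word size bounds a quantity that is at most exponential in the number
of variables. Stating it for all large `c` allows it to be combined with the word size of the
`k`-Sum program. -/
theorem eventually_fits {q : ℕ} (P : Params) : ∀ᶠ c in atTop, ∀ φ : KCNF q,
    Fits P φ.numVars φ.clauses.length (base P φ) (c * (φ.numVars + 1)) := by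
  have hcode : ExpBdd fun φ : KCNF q => 2 * φ.numVars + 2 :=
    ((LinBdd.numVars.const_mul 2).add (.const 2)).expBdd
  have haddr : ExpBdd fun φ : KCNF q => base P φ + P.total φ.numVars :=
    (((ExpBdd.length_clauses.mul (.const _)).add (.total P)).add (.const 3)).add (.total P)
  have hf : LinBdd fun φ : KCNF q => P.f φ.numVars := (LinBdd.b P).add (.const _)
  have hexp : ExpBdd fun φ : KCNF q => (P.K + 2) * P.b φ.numVars + P.q * P.b φ.numVars +
      P.f φ.numVars * P.K + 2 ^ P.K * P.ell :=
    (((((LinBdd.b P).const_mul _).add ((LinBdd.b P).const_mul _)).add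
      (hf.mul_const _)).add (.const _)).expBdd
  have hcap : ExpBdd fun φ : KCNF q => P.cap φ.numVars := (ExpBdd.scale P).mul (.const _)
  have htop : ExpBdd fun φ : KCNF q => P.top φ.numVars := (ExpBdd.scale P).mul (.const _)
  have hval : ExpBdd fun φ : KCNF q => P.lam * P.cap φ.numVars + P.cap φ.numVars +
      P.top φ.numVars * 2 ^ (2 ^ P.K * P.ell) :=
    (((ExpBdd.const _).mul hcap).add hcap).add (htop.mul (.const _))
  have hhead : ExpBdd fun φ : KCNF q => P.scale φ.numVars * P.Uc + P.scale φ.numVars * P.Tc :=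
    ((ExpBdd.scale P).mul (.const _)).add ((ExpBdd.scale P).mul (.const _))
  filter_upwards [hcode.eventually, haddr.eventually, (ExpBdd.const (P.K + P.q + P.lam + P.ell +
    P.Uc + P.Tc + 2 ^ P.K + 2 ^ ((P.K + 1) * P.ell) + 2 ^ ((P.K + 3) * P.ell) + 3)).eventually,
    hexp.eventually, hval.eventually, hhead.eventually] with c h1 h2 h3 h4 h5 h6 φ
  exact ⟨h1 φ, h2 φ, rfl, h3 φ, h4 φ, h5 φ, h6 φ⟩

/-! ### Bounds on the running time -/

theorem exists_itemTime_le (P : Params) : ∃ c, ∀ m, itemTime P m ≤ c * (m + 1) := by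
  unfold itemTime
  generalize clauseHead.cost + (P.q * (literalBody.cost + 1) + 1 + clauseTail.cost) + 1 = x
  generalize P.K * (decodeBody.cost + 1) + 1 = y
  exact ⟨itemHead.cost + y + checkHead.cost + x + 1 + emit.cost, fun m => by nlinarith⟩

theorem exists_reduceTime_le (P : Params) : ∃ c, ∀ m t,
    reduceTime P m (m * (P.q + 1) + t + 3) t ≤ c * ((m + 1) * (t + 1)) := by
  obtain ⟨c, hc⟩ := exists_itemTime_le P
  unfold reduceTime
  generalize (setup P).cost = x1
  generalize clearBody.cost + 1 = x2
  generalize moveHead.cost = x3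
  generalize moveBody.cost + 1 = x4
  generalize (header P).cost = x5
  refine ⟨x1 + (c + 2) + (P.q + 4) * x2 + x3 + x4 + x5 + 50, fun m t => ?_⟩
  have h1 : t * (itemTime P m + 1) ≤ (c + 1) * ((m + 1) * (t + 1)) := by
    have := hc m
    calc t * (itemTime P m + 1) ≤ (t + 1) * ((c + 1) * (m + 1)) :=
          Nat.mul_le_mul (by omega) (by nlinarith)
      _ = _ := by ring
  have h2 : (m * (P.q + 1) + t + 3) * x2 ≤ (P.q + 4) * x2 * ((m + 1) * (t + 1)) := by
    have : m * (P.q + 1) + t + 3 ≤ (P.q + 4) * ((m + 1) * (t + 1)) := by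
      nlinarith [Nat.zero_le (m * t), Nat.zero_le (P.q * t), Nat.zero_le (P.q * m * t)]
    calc _ ≤ (P.q + 4) * ((m + 1) * (t + 1)) * x2 := Nat.mul_le_mul_right _ this
      _ = _ := by ring
  have h3 : 1 ≤ (m + 1) * (t + 1) := Nat.mul_pos (by omega) (by omega)
  have h4 : t * x4 ≤ x4 * ((m + 1) * (t + 1)) := by
    rw [mul_comm]; exact Nat.mul_le_mul_left _ (by nlinarith)
  generalize (m + 1) * (t + 1) = y at *
  nlinarith [Nat.le_mul_of_pos_right x1 h3, Nat.le_mul_of_pos_right x3 h3,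
    Nat.le_mul_of_pos_right x5 h3]

theorem exists_pow_le_two_rpow (q : ℕ) : ∃ C : ℝ, 0 ≤ C ∧ ∀ n : ℕ,
    (((2 * n + 1) ^ q : ℕ) : ℝ) ≤ C * (2 : ℝ) ^ ((n : ℝ) / 4) := by
  have hr : (1 : ℝ) < (2 : ℝ) ^ ((1 : ℝ) / 4) := Real.one_lt_rpow (by norm_num) (by norm_num)
  obtain ⟨B, hB⟩ := (tendsto_pow_const_div_const_pow_of_one_lt q hr).bddAbove_range
  have hB' : ∀ n : ℕ, (n : ℝ) ^ q ≤ B * ((2 : ℝ) ^ ((1 : ℝ) / 4)) ^ n := fun n =>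
    (div_le_iff₀ (by positivity)).1 (hB ⟨n, rfl⟩)
  have hB0 : 0 ≤ B := by
    have := hB' 1
    rw [Nat.cast_one, one_pow] at this
    by_contra h
    nlinarith [Real.rpow_pos_of_pos (show (0 : ℝ) < 2 by norm_num) ((1 : ℝ) / 4)]
  refine ⟨2 ^ q * (B * (2 : ℝ) ^ ((1 : ℝ) / 4)), by positivity, fun n => ?_⟩
  have h1 := hB' (n + 1)
  have h2 : ((2 : ℝ) ^ ((1 : ℝ) / 4)) ^ n = (2 : ℝ) ^ ((n : ℝ) / 4) := by
    rw [← Real.rpow_natCast, ← Real.rpow_mul (by norm_num)]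
    congr 1
    ring
  rw [pow_succ, h2] at h1
  calc (((2 * n + 1) ^ q : ℕ) : ℝ) ≤ (2 * ((n + 1 : ℕ) : ℝ)) ^ q := by
        push_cast
        gcongr
        linarith
    _ = 2 ^ q * ((n + 1 : ℕ) : ℝ) ^ q := mul_pow _ _ _
    _ ≤ 2 ^ q * (B * ((2 : ℝ) ^ ((n : ℝ) / 4) * (2 : ℝ) ^ ((1 : ℝ) / 4))) := by gcongr
    _ = _ := by ring

/-- The codes contribute `2 ^ (q * b)`, and `q * (n / K) ≤ n / 4`. The rounding in `b` and the
number of masks cost only constant factors. -/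
theorem exists_total_le {P : Params} (hK : 4 * P.q ≤ P.K) : ∃ C : ℝ, 0 ≤ C ∧ ∀ n : ℕ,
    (P.total n : ℝ) ≤ C * (2 : ℝ) ^ ((n : ℝ) / 4) := by
  refine ⟨2 ^ P.q * 2 ^ P.K, by positivity, fun n => ?_⟩
  have h1 : ((P.q * (n / P.K) : ℕ) : ℝ) ≤ (n : ℝ) / 4 := by
    have h2 : 4 * (P.q * (n / P.K)) ≤ n := by
      calc 4 * (P.q * (n / P.K)) = 4 * P.q * (n / P.K) := by ring
        _ ≤ P.K * (n / P.K) := Nat.mul_le_mul_right _ hK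
        _ ≤ n := Nat.mul_div_le _ _
    have h3 : (4 : ℝ) * ((P.q * (n / P.K) : ℕ) : ℝ) ≤ n := by exact_mod_cast h2
    linarith
  have h4 : (P.total n : ℝ) = 2 ^ P.q * 2 ^ P.K * (2 : ℝ) ^ (((P.q * (n / P.K) : ℕ) : ℝ)) := by
    rw [Real.rpow_natCast, Params.total, Params.b]
    push_cast
    ring
  rw [h4]
  gcongr
  norm_num

/-! ### The choice of constants and the two implications. -/

/-- The constants of the reduction, for a `k`-Sum range of `E` additional bits. -/
def params (K q E : ℕ) : Params where
  K := K
  q := q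
  lam := (K - 1).choose (q - 1)
  -- A sum of `lam` and the number of summands, so that `x < 2 ^ x` bounds both of them by `2 ^
  -- ell`.
  ell := (K - 1).choose (q - 1) + (K.choose q + K)
  Uc := 2 ^ E
  Tc := (K - 1).choose (q - 1) * K *
      2 ^ ((K + 1) * ((K - 1).choose (q - 1) + (K.choose q + K))) +
    2 ^ ((K + 3) * ((K - 1).choose (q - 1) + (K.choose q + K))) *
      ∑ M ∈ masks K 1 ∪ masks K q, (2 ^ ((K - 1).choose (q - 1) + (K.choose q + K))) ^ M

theorem good_params {K q : ℕ} (E : ℕ) (hq : 2 ≤ q) (hK : q ≤ K) : (params K q E).Good where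
  two_le_q := hq
  q_le_K := hK
  lam_eq := rfl
  lam_lt := Nat.lt_two_pow_self.trans_le (Nat.pow_le_pow_right (by norm_num) (Nat.le_add_right _ _))
  picks_lt := Nat.lt_two_pow_self.trans_le (Nat.pow_le_pow_right (by norm_num) (Nat.le_add_left _ _))
  Tc_eq := rfl

theorem Params.Good.value_pos_le {P : Params} (hP : P.Good) {n E : ℕ} (hU : P.Uc = 2 ^ E)
    (hE : (P.K + 3) * P.ell + 2 ^ P.K * P.ell + 1 ≤ E) {M e : ℕ} (hM : M < 2 ^ P.K) :
    1 ≤ P.value n M e ∧ P.value n M e ≤ P.scale n * P.Uc := by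
  have h1 := hP.low_lt_top (n := n) M e
  have h2 : P.top n * 2 ^ (M * P.ell) ≤ P.top n * 2 ^ (2 ^ P.K * P.ell) :=
    Nat.mul_le_mul_left _ (Nat.pow_le_pow_right (by norm_num) (Nat.mul_le_mul_right _ hM.le))
  have h3 : P.top n ≤ P.top n * 2 ^ (M * P.ell) := Nat.le_mul_of_pos_right _ (by positivity)
  -- The factor `2` covers the low part, which is below `top`; it accounts for the `+ 1` in `hE`.
  have h4 : P.top n * 2 ^ (2 ^ P.K * P.ell) * 2 ≤ P.scale n * P.Uc := by
    rw [hU, top, mul_assoc, mul_assoc, ← pow_succ, ← pow_add]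
    exact Nat.mul_le_mul_left _ (Nat.pow_le_pow_right (by norm_num) (by omega))
  unfold value
  omega

/-- The `k`-Sum instance for a formula. -/
noncomputable def toKSum {P : Params} (hP : P.Good) {E : ℕ} (hU : P.Uc = 2 ^ E)
    (hE : (P.K + 3) * P.ell + 2 ^ P.K * P.ell + 1 ≤ E) {q : ℕ} (φ : KCNF q) : KSumInstance where
  U := P.scale φ.numVars * P.Uc
  T := P.scale φ.numVars * P.Tc
  Z := P.items φ 0
  one_le_U := Nat.mul_pos (by unfold Params.scale; positivity) (by rw [hU]; positivity)
  nodup := hP.nodup_items φ 0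
  mem_range z hz := by
    obtain ⟨M, hM, e, -, -, rfl⟩ := Params.mem_items.1 hz
    exact hP.value_pos_le hU hE hM

/-- The hypotheses on `K` and `E` are used as follows: `4 * q ≤ K` makes the reduction cheap, `hαK`
and `hαE` give the density promise for the variable and the constant part of the exponent, `hE`
makes `U` exceed all numbers, and `hKε` pays for the exponent `(K + 2) / K` of `U`. -/
theorem KSATSolvable_of_KSumSolvable {q K E : ℕ} {α ε ε' : ℝ} (hq : 2 ≤ q) (hK : 4 * q ≤ K)
    (hα : 0 < α) (hαK : q ≤ α * K) (hαE : K ≤ α * E)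
    (hE : (K + 3) * (params K q E).ell + 2 ^ K * (params K q E).ell + 1 ≤ E)
    (hε' : 0 ≤ ε') (hε : ε' ≤ ε) (hε1 : ε' ≤ 1) (hKε : 4 ≤ ε' * K)
    (h : KSumSolvable (K.choose q + K) (fun x => (x.N : ℝ) ≤ (x.U : ℝ) ^ α)
      fun x => (x.U : ℝ) ^ (1 - ε)) :
    KSATSolvable q fun N => (2 : ℝ) ^ ((1 - ε' / 2) * N) := by
  set P := params K q E with hPdef
  have hP : P.Good := good_params E hq (by omega)
  obtain ⟨p, c, C, hp⟩ := h
  set X : KCNF q → KSumInstance := fun φ => toKSum (P := P) hP rfl hE φ with hX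
  have hb : ∀ φ : KCNF q, ((X φ).U : ℝ) = (2 : ℝ) ^ (((K + 2 : ℝ) * P.b φ.numVars + E)) := by
    intro φ
    rw [show (X φ).U = 2 ^ ((K + 2) * P.b φ.numVars + E) from (pow_add _ _ _).symm]
    push_cast
    rw [← Real.rpow_natCast]
    push_cast
    rfl
  have hprom : ∀ φ, ((X φ).N : ℝ) ≤ ((X φ).U : ℝ) ^ α := by
    intro φ
    have h1 : (X φ).N ≤ 2 ^ (q * P.b φ.numVars + K) := by
      rw [pow_add]
      exact (P.length_items_le φ 0).trans (Nat.sub_le _ _)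
    calc ((X φ).N : ℝ) ≤ ((2 ^ (q * P.b φ.numVars + K) : ℕ) : ℝ) := by exact_mod_cast h1
      _ = (2 : ℝ) ^ ((q : ℝ) * P.b φ.numVars + K) := by
        push_cast
        rw [← Real.rpow_natCast]
        push_cast
        rfl
      _ ≤ (2 : ℝ) ^ ((((K + 2 : ℝ) * P.b φ.numVars + E)) * α) := by
        apply Real.rpow_le_rpow_of_exponent_le (by norm_num)
        have h2 : (0 : ℝ) ≤ P.b φ.numVars := by positivity
        nlinarith [mul_le_mul_of_nonneg_right hαK h2, mul_nonneg hα.le h2]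
      _ = _ := by rw [hb, ← Real.rpow_mul (by norm_num)]
  have hUle : ∀ φ, ((X φ).U : ℝ) ^ (1 - ε) ≤
      (2 : ℝ) ^ ((K : ℝ) + 2 + E) * (2 : ℝ) ^ ((1 - ε' / 2) * φ.numVars) := by
    intro φ
    have h1 : (1 : ℝ) ≤ (X φ).U := by exact_mod_cast (X φ).one_le_U
    refine (Real.rpow_le_rpow_of_exponent_le h1 (show 1 - ε ≤ 1 - ε' by linarith)).trans ?_
    rw [hb, ← Real.rpow_mul (by norm_num), ← Real.rpow_add (by norm_num)]
    apply Real.rpow_le_rpow_of_exponent_le (by norm_num)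
    have hKpos : (0 : ℝ) < K := by
      have : 0 < K := by omega
      exact_mod_cast this
    have h2 : (P.b φ.numVars : ℝ) ≤ φ.numVars / K + 1 := by
      change ((φ.numVars / K + 1 : ℕ) : ℝ) ≤ _
      push_cast
      gcongr
      exact Nat.cast_div_le
    have h3 : ((K + 2 : ℝ) * P.b φ.numVars + E) * (1 - ε') ≤
        ((K + 2 : ℝ) * (φ.numVars / K + 1) + E) * (1 - ε') := by
      gcongr
    refine h3.trans ?_
    have h4 : (2 : ℝ) / K ≤ ε' / 2 := by
      rw [div_le_div_iff₀ hKpos (by norm_num)]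
      linarith
    have h5 : (K + 2 : ℝ) * (φ.numVars / K + 1) = φ.numVars * (1 + 2 / K) + (K + 2) := by
      field_simp
    rw [h5]
    have h6 : (0 : ℝ) ≤ φ.numVars := by positivity
    -- With `2 / K ≤ ε' / 2`, the product is at most `(1 + ε' / 2) * (1 - ε') ≤ 1 - ε' / 2`.
    have h7 : (1 + 2 / (K : ℝ)) * (1 - ε') ≤ 1 - ε' / 2 := by nlinarith
    have h8 : (0 : ℝ) ≤ ((K : ℝ) + 2 + E) * ε' := by positivity
    nlinarith [mul_le_mul_of_nonneg_left h7 h6]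
  obtain ⟨C₁, hC₁, hcount⟩ := exists_pow_le_two_rpow q
  obtain ⟨C₂, hC₂, htotal⟩ := exists_total_le (P := P) hK
  obtain ⟨c₃, htime⟩ := exists_reduceTime_le P
  have hsize : ExpBdd fun φ => (X φ).U + (X φ).T :=
    ((ExpBdd.scale P).mul (.const _)).add ((ExpBdd.scale P).mul (.const _))
  obtain ⟨c₁, hc₁⟩ := hsize
  -- One word size serves both the reduction and the `k`-Sum program, whose execution carries over
  -- to larger words.
  obtain ⟨c₂, hfit, hc₂⟩ := ((eventually_fits (q := q) P).and
    (eventually_ge_atTop (c * c₁))).exists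
  refine ⟨.seq (reduce P) p, c₂, ⌈c₃ * ((C₁ + 1) * (C₂ + 1)) +
    C * (2 : ℝ) ^ ((K : ℝ) + 2 + E)⌉₊, fun φ _ => ?_⟩
  have hinp : φ.input.length ≤ base P φ := (length_input_le φ).trans (by
    change _ ≤ φ.clauses.length * (q + 1) + P.total φ.numVars + 3
    omega)
  obtain ⟨n₁, s₁, e₁, hn₁, rfl⟩ := runs_reduce hP rfl (hfit φ) hinp
  obtain ⟨n₂, s₂, e₂, hn₂, hyes⟩ := hp (X φ) (hprom φ)
  refine ⟨n₁ + n₂, s₂, .seq e₁ (e₂.mono ?_), ?_, hyes.trans (hP.hasKSum_iff φ)⟩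
  · calc c * Nat.size ((X φ).U + (X φ).T) ≤ c * (c₁ * (φ.numVars + 1)) :=
          Nat.mul_le_mul_left _ (Nat.size_le.2 (hc₁ φ))
      _ = c * c₁ * (φ.numVars + 1) := by ring
      _ ≤ _ := Nat.mul_le_mul_right _ hc₂
  · set y : ℝ := (2 : ℝ) ^ ((φ.numVars : ℝ) / 4) with hy
    set Y : ℝ := (2 : ℝ) ^ ((1 - ε' / 2) * φ.numVars) with hY
    have hy1 : 1 ≤ y := Real.one_le_rpow (by norm_num) (by positivity)
    -- The clauses and the partial assignments contribute `2 ^ (n / 4)` each; `ε' ≤ 1` makes `n / 2`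
    -- small enough.
    have hyY : y * y ≤ Y := by
      rw [hy, hY, ← Real.rpow_add (by norm_num)]
      apply Real.rpow_le_rpow_of_exponent_le (by norm_num)
      have : (0 : ℝ) ≤ φ.numVars := by positivity
      nlinarith
    have h1 : (n₁ : ℝ) ≤ c₃ * ((C₁ + 1) * (C₂ + 1)) * Y := by
      have h2 : (n₁ : ℝ) ≤ c₃ * ((φ.clauses.length + 1) * (P.total φ.numVars + 1)) := by
        exact_mod_cast hn₁.trans (htime _ _)
      have h3 : (φ.clauses.length : ℝ) + 1 ≤ (C₁ + 1) * y := by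
        have h4 : (φ.clauses.length : ℝ) ≤ C₁ * y :=
          le_trans (by exact_mod_cast length_clauses_le φ) (hcount φ.numVars)
        linarith
      have h5 : (P.total φ.numVars : ℝ) + 1 ≤ (C₂ + 1) * y := by
        have := htotal φ.numVars
        linarith
      calc (n₁ : ℝ) ≤ c₃ * ((φ.clauses.length + 1) * (P.total φ.numVars + 1)) := h2
        _ ≤ c₃ * (((C₁ + 1) * y) * ((C₂ + 1) * y)) := by gcongr
        _ = c₃ * ((C₁ + 1) * (C₂ + 1)) * (y * y) := by ring
        _ ≤ _ := by gcongr
    have h6 : (n₂ : ℝ) ≤ C * (2 : ℝ) ^ ((K : ℝ) + 2 + E) * Y := by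
      rw [mul_assoc]
      exact hn₂.trans (mul_le_mul_of_nonneg_left (hUle φ) (by positivity))
    have hY0 : 0 ≤ Y := by positivity
    have h7 := mul_le_mul_of_nonneg_right (Nat.le_ceil (c₃ * ((C₁ + 1) * (C₂ + 1)) +
      C * (2 : ℝ) ^ ((K : ℝ) + 2 + E))) hY0
    push_cast
    linarith

theorem intermediate_of_SETH (hS : SETH) : IntermediateHypothesis := by
  intro α ε hα hε
  by_contra! hcon
  set ε' := min ε 1 with hε'
  have hε'0 : 0 < ε' := lt_min hε one_pos
  obtain ⟨q, hq, hns⟩ := hS (ε' / 2) (by positivity)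
  set K : ℕ := 4 * q + ⌈q / α⌉₊ + ⌈4 / ε'⌉₊ with hK
  set L : ℕ := (K - 1).choose (q - 1) + (K.choose q + K) with hL
  -- There is no circularity: the field constant `L` does not depend on `E`.
  set E : ℕ := ⌈K / α⌉₊ + ((K + 3) * L + 2 ^ K * L + 1) with hE
  refine hns (KSATSolvable_of_KSumSolvable (K := K) (E := E) (α := α) (ε := ε) (by omega)
    (by omega) hα ?_ ?_ (Nat.le_add_left _ _) hε'0.le (min_le_left _ _) (min_le_right _ _) ?_
    (hcon _ (by omega)))
  · rw [← div_le_iff₀' hα]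
    refine (Nat.le_ceil _).trans ?_
    exact_mod_cast (by omega : ⌈q / α⌉₊ ≤ K)
  · rw [← div_le_iff₀' hα]
    refine (Nat.le_ceil _).trans ?_
    exact_mod_cast Nat.le_add_right _ _
  · rw [← div_le_iff₀' hε'0]
    refine (Nat.le_ceil _).trans ?_
    exact_mod_cast (by omega : ⌈4 / ε'⌉₊ ≤ K)

/-- Take `k` so large that `r = ⌈k / 2⌉` is at least `1 / α`. The same program then refutes the
Strong `k`-Sum Hypothesis with saving `r * ε`. -/
theorem intermediate_of_strongKSum (hS : StrongKSumHypothesis) : IntermediateHypothesis := by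
  intro α ε hα hε
  set k : ℕ := 3 + 2 * ⌈1 / α⌉₊ with hk
  set r : ℕ := ⌈(k : ℝ) / 2⌉₊ with hr
  have hkr : (k : ℝ) / 2 ≤ r := Nat.le_ceil _
  have hr0 : (0 : ℝ) < r := lt_of_lt_of_le (by rw [hk]; positivity) hkr
  have hαr : 1 ≤ r * α := by
    rw [← div_le_iff₀ hα]
    refine ((Nat.le_ceil (1 / α)).trans ?_).trans hkr
    rw [hk]
    push_cast
    linarith
  refine ⟨k, by omega, fun ⟨p, c, C, h⟩ => hS k (by omega) (r * ε) (by positivity)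
    ⟨p, c, C, fun x hx => ?_⟩⟩
  have hx : x.U = x.N ^ r := hx
  -- An empty set would force `U = 0`, as `r` is positive; `N ≥ 1` makes powers of `N` monotone in
  -- the exponent.
  have hN : 1 ≤ x.N := by
    by_contra hN
    have hU := x.one_le_U
    rw [hx, show x.N = 0 by omega, zero_pow (by rintro h0; simp [h0] at hr0)] at hU
    omega
  have hN' : (1 : ℝ) ≤ x.N := by exact_mod_cast hN
  have hU : ∀ a : ℝ, (x.U : ℝ) ^ a = (x.N : ℝ) ^ (r * a) := by
    intro a
    rw [hx]
    push_cast
    rw [← Real.rpow_natCast, ← Real.rpow_mul (by positivity)]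
  obtain ⟨n, s, he, hn, hs⟩ := h x (by
    change (x.N : ℝ) ≤ (x.U : ℝ) ^ α
    rw [hU]
    simpa using Real.rpow_le_rpow_of_exponent_le hN' hαr)
  refine ⟨n, s, he, hn.trans (le_of_eq ?_), hs⟩
  simp only
  rw [hU, mul_sub, mul_one]

end SATToKSum

theorem lemma5p2 :
    (SETH → IntermediateHypothesis) ∧ (StrongKSumHypothesis → IntermediateHypothesis) :=
  ⟨SATToKSum.intermediate_of_SETH, SATToKSum.intermediate_of_strongKSum⟩
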